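/- Let $M$ and $N$ be smooth manifolds modelled on real Banach spaces $\mathbb E$ and $\mathbb E'$, let $g:M\to N$ be a smooth map and let $k\ge 1$. Let $T^kM$ denote the tangent bundle of order $k$, i.e. the manifold of classes $[\gamma,x]_k$ of smooth curves $\gamma:(-\epsilon,\epsilon)\to M$ with $\gamma(0)=x$, two curves through $x$ being identified when their derivatives at $0$ of order $1,\dots,k$ agree in charts; let $\pi^k_M:T^kM\to M$ be the projection; a chart $\varphi:U\to\mathbb E$ of $M$ induces the chart $\varphi^k([\gamma,x]_k)=\big((\varphi\circ\gamma)(0),(\varphi\circ\gamma)'(0),\dots,\tfrac1{k!}(\varphi\circ\gamma)^{(k)}(0)\big)$ of $T^kM$. Put $T^kg([\gamma,x]_k)=[g\circ\gamma,g(x)]_k$. Let $\mathbb J$ be the endomorphism of $TT^kM$ given in the charts $\varphi^k$ by $(u;y,\eta_1,\dots,\eta_k)\mapsto(u;0,y,\eta_1,\dots,\eta_{k-1})$. A connection map on $T^kM$ is a smooth vector bundle morphism $K=(K^1,\dots,K^k):TT^kM\to\bigoplus_{i=1}^kTM$ over $\pi^k_M$ with $K^k\circ\mathbb J^a=K^{k-a}$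 for $1\le a\le k-1$ and $K^k\circ\mathbb J^k=(\pi^k_M)_*$. Connection maps $K_M$ on $T^kM$ and $K_N$ on $T^kN$ are called $g$-related if $$K_N\circ TT^kg=\Big(\bigoplus_{i=1}^kTg\Big)\circ K_M .$$ A smooth linear connection $\nabla_M$ on $M$ is given by its Christoffel symbols $\Gamma_\varphi(x)(\xi,y)$ (continuous bilinear in $(\xi,y)$, smooth in $x\in\varphi(U)$, one for each chart $\varphi$ of the atlas), which satisfy for every change of charts $\tau=\psi\circ\varphi^{-1}$ $$d\tau(x)\,\Gamma_\varphi(x)(\xi,y)=d^2\tau(x)(\xi,y)+\Gamma_\psi(\tau(x))\big(d\tau(x)\xi,d\tau(x)y\big).$$ Its connection map on $T^1M=TM$ is $(x,\xi;y,\eta)\mapsto\big(x,\eta+\Gamma_\varphi(x)(\xi,y)\big)$ in charts, and two linear connections $\nabla_M$, $\nabla_N$ are called $g$-related if their connection maps on $TM$ and $TN$ are $g$-related. The connection $\nabla_M$ induces on $T^kM$ the map $K_M=(K^1_M,\dots,K^k_M)$ given in the chart $\varphi^k$, at $u=(x,\xi_1,\dots,\xi_k)$, by $$K^i_M(u;y,\eta_1,\dots,\eta_k)=\Big(x,\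 \eta_i+M^1_\varphi(u)\eta_{i-1}+\dots+M^{i-1}_\varphi(u)\eta_1+M^i_\varphi(u)y\Big),\qquad 1\le i\le k,$$ where $M^1_\varphi(x,\xi_1)y=\Gamma_\varphi(x)(\xi_1,y)$ and, for $i\ge2$, $$M^i_\varphi(x,\xi_1,\dots,\xi_i)y=\frac1i\Big(\sum_{j=1}^{i}\partial_jM^{i-1}_\varphi(x,\xi_1,\dots,\xi_{i-1})(y,j\xi_j)+M^1_\varphi(x,\xi_1)\big[M^{i-1}_\varphi(x,\xi_1,\dots,\xi_{i-1})y\big]\Big),$$ $\partial_j$ being the partial derivative with respect to the $j$-th of the variables $x,\xi_1,\dots,\xi_{i-1}$. The map $K_N$ on $T^kN$ is defined in the same way from $\nabla_N$. **Proposition.** If the linear connections $\nabla_M$ and $\nabla_N$ are $g$-related, then $K_M$ and $K_N$ (which are well-defined connection maps, given by the above local formulas in every chart of the atlas) are $g$-related connection maps: $$K_N\circ TT^kg=\Big(\bigoplus_{i=1}^kTg\Big)\circ K_M .$$ -/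

import Mathlib

open Set Filter Topology
open scoped Manifold ContDiff

noncomputable section

namespace HigherTangent

/-! ### Calculus of jets of curves in normed spaces -/

section Calculus

variable {E : Type*} [NormedAddCommGroup E] [NormedSpace ℝ E]
  {F : Type*} [NormedAddCommGroup F] [NormedSpace ℝ F]
  {P : Type*} [NormedAddCommGroup P] [NormedSpace ℝ P]

theorem iteratedDeriv_comp_eq_of_jet_eq {τ : E → F} {f h : ℝ → E} {n : ℕ}
    (hτ : ContDiffAt ℝ ∞ τ (f 0)) (hf : ContDiffAt ℝ ∞ f 0) (hh : ContDiffAt ℝ ∞ h 0)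
    (hfh : ∀ j ≤ n, iteratedDeriv j f 0 = iteratedDeriv j h 0) :
    iteratedDeriv n (τ ∘ f) 0 = iteratedDeriv n (τ ∘ h) 0 := by
  have h0 : f 0 = h 0 := by simpa using hfh 0 (Nat.zero_le _)
  have hn : (n : ℕ∞ω) ≤ ∞ := by exact_mod_cast le_top
  rw [iteratedDeriv_vcomp_eq_sum_orderedFinpartition hτ hf hn,
    iteratedDeriv_vcomp_eq_sum_orderedFinpartition (h0 ▸ hτ) hh hn, h0]
  refine Finset.sum_congr rfl fun c _ => ?_
  congr 1
  funext j
  exact hfh _ (c.partSize_le j)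

/-- The polynomial curve `t ↦ p₀ + t p₁ + ⋯ + tᵏ pₖ`. -/
def polyCurve {k : ℕ} (p : Fin (k + 1) → E) (t : ℝ) : E := ∑ j : Fin (k + 1), t ^ (j : ℕ) • p j

theorem polyCurve_zero {k : ℕ} (p : Fin (k + 1) → E) : polyCurve p 0 = p 0 := by
  simp [polyCurve, Fin.sum_univ_succ]

theorem contDiff_polyCurve_uncurry (k : ℕ) :
    ContDiff ℝ ∞ (fun q : (Fin (k + 1) → E) × ℝ => polyCurve q.1 q.2) := by
  unfold polyCurve
  fun_prop

theorem contDiff_polyCurve {k : ℕ} (p : Fin (k + 1) → E) : ContDiff ℝ ∞ (polyCurve p) := by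
  unfold polyCurve
  fun_prop

theorem iteratedDeriv_polyCurve {k : ℕ} (p : Fin (k + 1) → E) (j : Fin (k + 1)) :
    iteratedDeriv (j : ℕ) (polyCurve p) 0 = ((j : ℕ).factorial : ℝ) • p j := by
  unfold polyCurve
  rw [iteratedDeriv_fun_sum (fun i _ => by fun_prop), Finset.sum_eq_single j]
  · rw [iteratedDeriv_smul_const (by fun_prop), iteratedDeriv_fun_pow_zero]
    simp
  · intro i _ hij
    have : (j : ℕ) ≠ i := fun h => hij (Fin.ext h.symm)
    rw [iteratedDeriv_smul_const (by fun_prop), iteratedDeriv_fun_pow_zero]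
    simp [this]
  · simp

theorem contDiffOn_iteratedDeriv {W : Set (P × ℝ)} (hW : IsOpen W) {G : P × ℝ → F}
    (hG : ContDiffOn ℝ ∞ G W) (n : ℕ) :
    ContDiffOn ℝ ∞ (fun q : P × ℝ => iteratedDeriv n (fun s => G (q.1, s)) q.2) W := by
  induction n with
  | zero => simpa using hG
  | succ n ih =>
    have hd := (ih.fderiv_of_isOpen (m := ∞) hW (by simp)).clm_apply
      (contDiffOn_const (c := ((0, 1) : P × ℝ)))
    refine hd.congr fun q hq => ?_
    rw [iteratedDeriv_succ]
    have h1 := ((ih.contDiffAt (hW.mem_nhds hq)).differentiableAt (by simp)).hasFDerivAt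
    have h2 : HasDerivAt (fun s : ℝ => ((q.1, s) : P × ℝ)) (0, 1) q.2 :=
      (hasDerivAt_const _ _).prodMk (hasDerivAt_id _)
    exact (h1.comp_hasDerivAt q.2 h2).deriv

/-- The normalised `k`-jet at `0` of a curve: `(f(0), f'(0), …, f⁽ᵏ⁾(0) / k!)`. -/
def curveJet (k : ℕ) (f : ℝ → E) : Fin (k + 1) → E :=
  fun j => ((j : ℕ).factorial : ℝ)⁻¹ • iteratedDeriv (j : ℕ) f 0

theorem curveJet_zero (k : ℕ) (f : ℝ → E) : curveJet k f 0 = f 0 := by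
  simp [curveJet]

theorem curveJet_polyCurve {k : ℕ} (p : Fin (k + 1) → E) : curveJet k (polyCurve p) = p := by
  funext j
  rw [curveJet, iteratedDeriv_polyCurve, inv_smul_smul₀ (by positivity)]

theorem curveJet_eq_iff {k : ℕ} {f h : ℝ → E} :
    curveJet k f = curveJet k h ↔ ∀ j ≤ k, iteratedDeriv j f 0 = iteratedDeriv j h 0 := by
  constructor
  · intro H j hj
    have := congrFun H ⟨j, Nat.lt_succ_of_le hj⟩
    exact smul_right_injective E (inv_ne_zero (by positivity : (j.factorial : ℝ) ≠ 0)) this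
  · intro H
    funext j
    rw [curveJet, curveJet, H _ (Nat.lt_succ_iff.1 j.2)]

theorem curveJet_congr {k : ℕ} {f h : ℝ → E} (H : f =ᶠ[𝓝 0] h) : curveJet k f = curveJet k h :=
  curveJet_eq_iff.2 fun j _ => (H.iteratedDeriv_eq j)

theorem curveJet_comp_eq {k : ℕ} {τ : E → F} {f h : ℝ → E} (hτ : ContDiffAt ℝ ∞ τ (f 0))
    (hf : ContDiffAt ℝ ∞ f 0) (hh : ContDiffAt ℝ ∞ h 0) (H : curveJet k f = curveJet k h) :
    curveJet k (τ ∘ f) = curveJet k (τ ∘ h) :=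
  curveJet_eq_iff.2 fun _ hj => iteratedDeriv_comp_eq_of_jet_eq hτ hf hh
    fun i hi => curveJet_eq_iff.1 H i (hi.trans hj)

theorem contDiffOn_curveJet_comp_polyCurve {k : ℕ} {τ : E → F} {S : Set E} (hS : IsOpen S)
    (hτ : ContDiffOn ℝ ∞ τ S) :
    ContDiffOn ℝ ∞ (fun p : Fin (k + 1) → E => curveJet k (τ ∘ polyCurve p)) {p | p 0 ∈ S} := by
  have hW : IsOpen ((fun q : (Fin (k + 1) → E) × ℝ => polyCurve q.1 q.2) ⁻¹' S) :=
    hS.preimage (contDiff_polyCurve_uncurry k).continuous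
  have hG : ContDiffOn ℝ ∞ (fun q : (Fin (k + 1) → E) × ℝ => τ (polyCurve q.1 q.2))
      ((fun q : (Fin (k + 1) → E) × ℝ => polyCurve q.1 q.2) ⁻¹' S) :=
    hτ.comp (contDiff_polyCurve_uncurry k).contDiffOn fun _ h => h
  refine contDiffOn_pi.2 fun j => ?_
  have h1 := contDiffOn_iteratedDeriv hW hG j
  have h2 : ContDiffOn ℝ ∞ (fun p : Fin (k + 1) → E => ((p, 0) : (Fin (k + 1) → E) × ℝ))
      {p | p 0 ∈ S} := by fun_prop
  exact contDiffOn_const.smul (h1.comp h2 fun p hp => by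
    simpa [polyCurve_zero] using hp)

end Calculus

/-! ### Smooth curves and their chart representations -/

section Curves

variable {E : Type*} [NormedAddCommGroup E] [NormedSpace ℝ E]
  {E' : Type*} [NormedAddCommGroup E'] [NormedSpace ℝ E']
  {M : Type*} [TopologicalSpace M] [ChartedSpace E M]
  {N : Type*} [TopologicalSpace N] [ChartedSpace E' N]

/-- `γ` restricts to a smooth curve `(-ε, ε) → M` for some `ε > 0`. -/
def IsSmoothCurve (E : Type*) [NormedAddCommGroup E] [NormedSpace ℝ E]
    {M : Type*} [TopologicalSpace M] [ChartedSpace E M] (γ : ℝ → M) : Prop :=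
  ∃ ε : ℝ, 0 < ε ∧ ContMDiffOn 𝓘(ℝ, ℝ) 𝓘(ℝ, E) ∞ γ (Ioo (-ε) ε)

theorem IsSmoothCurve.contMDiffAt {γ : ℝ → M} (hγ : IsSmoothCurve E γ) :
    ContMDiffAt 𝓘(ℝ, ℝ) 𝓘(ℝ, E) ∞ γ 0 := by
  obtain ⟨ε, hε, h⟩ := hγ
  exact h.contMDiffAt (Ioo_mem_nhds (by linarith) hε)

theorem IsSmoothCurve.comp {γ : ℝ → M} (hγ : IsSmoothCurve E γ) {g : M → N}
    (hg : ContMDiff 𝓘(ℝ, E) 𝓘(ℝ, E') ∞ g) : IsSmoothCurve E' (g ∘ γ) := by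
  obtain ⟨ε, hε, h⟩ := hγ
  exact ⟨ε, hε, hg.comp_contMDiffOn h⟩

theorem isSmoothCurve_const (x : M) : IsSmoothCurve E (fun _ : ℝ => x) :=
  ⟨1, one_pos, contMDiffOn_const⟩

theorem contDiffAt_chart_comp_curve [IsManifold 𝓘(ℝ, E) ∞ M] {γ : ℝ → M}
    (hγ : IsSmoothCurve E γ) {φ : OpenPartialHomeomorph M E} (hφ : φ ∈ atlas E M)
    (h0 : γ 0 ∈ φ.source) : ContDiffAt ℝ ∞ (φ ∘ γ) 0 := by
  have h1 : ContMDiffAt 𝓘(ℝ, E) 𝓘(ℝ, E) ∞ φ (γ 0) :=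
    contMDiffAt_of_mem_maximalAtlas (IsManifold.subset_maximalAtlas hφ) h0
  exact (h1.comp 0 hγ.contMDiffAt).contDiffAt

theorem contDiffAt_chart_comp_symm [IsManifold 𝓘(ℝ, E) ∞ M] [IsManifold 𝓘(ℝ, E') ∞ N] {g : M → N}
    (hg : ContMDiff 𝓘(ℝ, E) 𝓘(ℝ, E') ∞ g) {φ : OpenPartialHomeomorph M E} (hφ : φ ∈ atlas E M)
    {ψ : OpenPartialHomeomorph N E'} (hψ : ψ ∈ atlas E' N) {x : E} (hx : x ∈ φ.target)
    (hx' : g (φ.symm x) ∈ ψ.source) : ContDiffAt ℝ ∞ (ψ ∘ g ∘ φ.symm) x := by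
  have h1 : ContMDiffAt 𝓘(ℝ, E') 𝓘(ℝ, E') ∞ ψ (g (φ.symm x)) :=
    contMDiffAt_of_mem_maximalAtlas (IsManifold.subset_maximalAtlas hψ) hx'
  have h2 : ContMDiffAt 𝓘(ℝ, E) 𝓘(ℝ, E) ∞ φ.symm x :=
    contMDiffAt_symm_of_mem_maximalAtlas (IsManifold.subset_maximalAtlas hφ) hx
  exact (h1.comp x ((hg _).comp x h2)).contDiffAt

theorem isSmoothCurve_symm_comp [IsManifold 𝓘(ℝ, E) ∞ M]
    {φ : OpenPartialHomeomorph M E} (hφ : φ ∈ atlas E M) {f : ℝ → E} (hf : ContDiff ℝ ∞ f)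
    (h0 : f 0 ∈ φ.target) : IsSmoothCurve E (φ.symm ∘ f) := by
  have hmem : f ⁻¹' φ.target ∈ 𝓝 (0 : ℝ) :=
    hf.continuous.continuousAt.preimage_mem_nhds (φ.open_target.mem_nhds h0)
  obtain ⟨ε, hε, hsub⟩ := Metric.mem_nhds_iff.1 hmem
  refine ⟨ε, hε, ?_⟩
  have h2 : ContMDiffOn 𝓘(ℝ, E) 𝓘(ℝ, E) ∞ φ.symm φ.target :=
    contMDiffOn_symm_of_mem_maximalAtlas (IsManifold.subset_maximalAtlas hφ)
  refine h2.comp hf.contMDiff.contMDiffOn fun t ht => hsub ?_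
  simpa [Real.ball_eq_Ioo] using ht

theorem chart_comp_eventuallyEq {X Y A B : Type*} [TopologicalSpace X] [TopologicalSpace Y]
    [TopologicalSpace A] [TopologicalSpace B] {γ : ℝ → X} (hγ : ContinuousAt γ 0) (g : X → Y)
    (φ : OpenPartialHomeomorph X A) (ψ : OpenPartialHomeomorph Y B) (h0 : γ 0 ∈ φ.source) :
    ψ ∘ g ∘ γ =ᶠ[𝓝 0] (ψ ∘ g ∘ φ.symm) ∘ (φ ∘ γ) := by
  filter_upwards [hγ.preimage_mem_nhds (φ.open_source.mem_nhds h0)] with t ht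
  simp [φ.left_inv ht]

/-- The key invariance: jets in one chart determine jets of the image curve in any other chart. -/
theorem curveJet_map_eq [IsManifold 𝓘(ℝ, E) ∞ M] [IsManifold 𝓘(ℝ, E') ∞ N] (k : ℕ) {g : M → N}
    (hg : ContMDiff 𝓘(ℝ, E) 𝓘(ℝ, E') ∞ g) {φ : OpenPartialHomeomorph M E} (hφ : φ ∈ atlas E M)
    {ψ : OpenPartialHomeomorph N E'} (hψ : ψ ∈ atlas E' N) {γ δ : ℝ → M}
    (hγ : IsSmoothCurve E γ) (hδ : IsSmoothCurve E δ) (h0 : γ 0 = δ 0) (hs : γ 0 ∈ φ.source)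
    (hs' : g (γ 0) ∈ ψ.source) (H : curveJet k (φ ∘ γ) = curveJet k (φ ∘ δ)) :
    curveJet k (ψ ∘ g ∘ γ) = curveJet k (ψ ∘ g ∘ δ) := by
  rw [curveJet_congr (chart_comp_eventuallyEq hγ.contMDiffAt.continuousAt g φ ψ hs),
    curveJet_congr (chart_comp_eventuallyEq hδ.contMDiffAt.continuousAt g φ ψ (h0 ▸ hs))]
  refine curveJet_comp_eq ?_ (contDiffAt_chart_comp_curve hγ hφ hs)
    (contDiffAt_chart_comp_curve hδ hφ (h0 ▸ hs)) H
  exact contDiffAt_chart_comp_symm hg hφ hψ (φ.map_source hs) (by simpa [φ.left_inv hs] using hs')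

end Curves

/-! ### The tangent bundle of order `k` -/

/-- Smooth curves `γ : (-ε, ε) → M`, represented by functions on `ℝ` whose values outside
the interval are irrelevant. -/
abbrev SmoothCurve (E : Type*) [NormedAddCommGroup E] [NormedSpace ℝ E]
    (M : Type*) [TopologicalSpace M] [ChartedSpace E M] : Type _ :=
  {γ : ℝ → M // IsSmoothCurve E γ}

/-- `γ₁ ≈ γ₂` iff both curves pass through the same point at time `0` and there, in every chart,
their derivatives of order `1, …, k` agree. -/
def jetSetoid (E : Type*) [NormedAddCommGroup E] [NormedSpace ℝ E] (k : ℕ)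
    (M : Type*) [TopologicalSpace M] [ChartedSpace E M] : Setoid (SmoothCurve E M) where
  r γ₁ γ₂ := γ₁.1 0 = γ₂.1 0 ∧ ∀ φ ∈ atlas E M, γ₁.1 0 ∈ φ.source →
    ∀ j : ℕ, 1 ≤ j → j ≤ k → iteratedDeriv j (φ ∘ γ₁.1) 0 = iteratedDeriv j (φ ∘ γ₂.1) 0
  iseqv :=
    { refl := fun _ => ⟨rfl, fun _ _ _ _ _ _ => rfl⟩
      symm := fun h => ⟨h.1.symm, fun φ hφ hs j h1 hk =>
        (h.2 φ hφ (h.1 ▸ hs) j h1 hk).symm⟩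
      trans := fun h h' => ⟨h.1.trans h'.1, fun φ hφ hs j h1 hk =>
        (h.2 φ hφ hs j h1 hk).trans (h'.2 φ hφ (h.1 ▸ hs) j h1 hk)⟩ }

/-- The tangent bundle of order `k` (`k`-osculating bundle) `TᵏM` of a manifold modelled on `E`. -/
def HigherTangentBundle (E : Type*) [NormedAddCommGroup E] [NormedSpace ℝ E] (k : ℕ)
    (M : Type*) [TopologicalSpace M] [ChartedSpace E M] : Type _ :=
  Quotient (jetSetoid E k M)

section Bundle

variable {E : Type*} [NormedAddCommGroup E] [NormedSpace ℝ E] {k : ℕ}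
  {E' : Type*} [NormedAddCommGroup E'] [NormedSpace ℝ E']
  {M : Type*} [TopologicalSpace M] [ChartedSpace E M]
  {N : Type*} [TopologicalSpace N] [ChartedSpace E' N]

theorem jetSetoid_r_iff {γ δ : SmoothCurve E M} :
    (jetSetoid E k M).r γ δ ↔ γ.1 0 = δ.1 0 ∧ ∀ φ ∈ atlas E M, γ.1 0 ∈ φ.source →
      curveJet k (φ ∘ γ.1) = curveJet k (φ ∘ δ.1) := by
  refine and_congr_right fun h0 => forall₃_congr fun φ _ _ => ?_
  rw [curveJet_eq_iff]
  refine ⟨fun H j hj => ?_, fun H j _ hj => H j hj⟩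
  rcases Nat.eq_zero_or_pos j with rfl | h
  · simp [h0]
  · exact H j h hj

theorem jetSetoid_r_of_chart [IsManifold 𝓘(ℝ, E) ∞ M] {γ δ : SmoothCurve E M}
    (h0 : γ.1 0 = δ.1 0) {φ : OpenPartialHomeomorph M E} (hφ : φ ∈ atlas E M)
    (hs : γ.1 0 ∈ φ.source) (H : curveJet k (φ ∘ γ.1) = curveJet k (φ ∘ δ.1)) :
    (jetSetoid E k M).r γ δ :=
  jetSetoid_r_iff.2 ⟨h0, fun _ hψ hs' =>
    curveJet_map_eq k (g := id) contMDiff_id hφ hψ γ.2 δ.2 h0 hs hs' H⟩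

/-- The class `[γ, γ(0)]ₖ`. -/
def HigherTangentBundle.mk (k : ℕ) (γ : SmoothCurve E M) : HigherTangentBundle E k M :=
  Quotient.mk (jetSetoid E k M) γ

theorem mk_eq_mk_iff {γ δ : SmoothCurve E M} :
    HigherTangentBundle.mk k γ = HigherTangentBundle.mk k δ ↔ (jetSetoid E k M).r γ δ :=
  Quotient.eq (r := jetSetoid E k M)

/-- The projection `πᵏ : TᵏM → M`. -/
def HigherTangentBundle.proj (u : HigherTangentBundle E k M) : M :=
  Quotient.lift (s := jetSetoid E k M) (fun γ : SmoothCurve E M => γ.1 0)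
    (fun γ δ (h : (jetSetoid E k M).r γ δ) => h.1) u

@[simp]
theorem proj_mk (γ : SmoothCurve E M) : (HigherTangentBundle.mk k γ).proj = γ.1 0 := rfl

/-- The coordinates `φᵏ([γ, x]ₖ) = ((φ ∘ γ)(0), (φ ∘ γ)'(0), …, (φ ∘ γ)⁽ᵏ⁾(0) / k!)`. They do not
depend on the representative when `x` is in the domain of `φ`. -/
def jetCoord (k : ℕ) (φ : OpenPartialHomeomorph M E) (u : HigherTangentBundle E k M) :
    Fin (k + 1) → E :=
  curveJet k (φ ∘ (Quotient.out u).1)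

theorem jetCoord_mk {φ : OpenPartialHomeomorph M E} (hφ : φ ∈ atlas E M) {γ : SmoothCurve E M}
    (hs : γ.1 0 ∈ φ.source) :
    jetCoord k φ (HigherTangentBundle.mk k γ) = curveJet k (φ ∘ γ.1) := by
  have h := Quotient.mk_out (s := jetSetoid E k M) γ
  have h' := jetSetoid_r_iff.1 h
  exact h'.2 φ hφ (h'.1 ▸ hs)

open Classical in
/-- The curve `t ↦ φ⁻¹(p₀ + t p₁ + ⋯ + tᵏ pₖ)` (constant if `p₀` is not in the range of `φ`). -/
def chartCurve [IsManifold 𝓘(ℝ, E) ∞ M] (φ : atlas E M) (p : Fin (k + 1) → E) :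
    SmoothCurve E M :=
  if h : p 0 ∈ φ.1.target then
    ⟨φ.1.symm ∘ polyCurve p, isSmoothCurve_symm_comp φ.2 (contDiff_polyCurve p)
      (by rwa [polyCurve_zero])⟩
  else ⟨fun _ => φ.1.symm (p 0), isSmoothCurve_const _⟩

theorem chartCurve_coe [IsManifold 𝓘(ℝ, E) ∞ M] (φ : atlas E M) {p : Fin (k + 1) → E}
    (h : p 0 ∈ φ.1.target) : (chartCurve φ p).1 = φ.1.symm ∘ polyCurve p := by
  rw [chartCurve, dif_pos h]

theorem chartCurve_zero [IsManifold 𝓘(ℝ, E) ∞ M] (φ : atlas E M) {p : Fin (k + 1) → E}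
    (h : p 0 ∈ φ.1.target) : (chartCurve φ p).1 0 = φ.1.symm (p 0) := by
  rw [chartCurve_coe φ h]; simp [polyCurve_zero]

theorem jetCoord_chartCurve [IsManifold 𝓘(ℝ, E) ∞ M] (φ : atlas E M) {p : Fin (k + 1) → E}
    (h : p 0 ∈ φ.1.target) (ψ : atlas E M) (h' : φ.1.symm (p 0) ∈ ψ.1.source) :
    jetCoord k ψ.1 (HigherTangentBundle.mk k (chartCurve φ p)) =
      curveJet k ((ψ.1 ∘ φ.1.symm) ∘ polyCurve p) := by
  rw [jetCoord_mk ψ.2 (by rwa [chartCurve_zero φ h]), chartCurve_coe φ h]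
  rfl

theorem jetCoord_chartCurve_self [IsManifold 𝓘(ℝ, E) ∞ M] (φ : atlas E M) {p : Fin (k + 1) → E}
    (h : p 0 ∈ φ.1.target) :
    jetCoord k φ.1 (HigherTangentBundle.mk k (chartCurve φ p)) = p := by
  rw [jetCoord_chartCurve φ h φ (φ.1.map_target h), curveJet_congr (h := polyCurve p),
    curveJet_polyCurve]
  have hmem := (contDiff_polyCurve p).continuous.continuousAt.preimage_mem_nhds
    (φ.1.open_target.mem_nhds (by rwa [polyCurve_zero] : polyCurve p 0 ∈ φ.1.target))
  filter_upwards [hmem] with t ht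
  exact φ.1.right_inv ht

/-- The chart `φᵏ : (πᵏ)⁻¹(U) → φ(U) × Eᵏ` of `TᵏM` attached to a chart `φ` of `M`. -/
def jetChart [IsManifold 𝓘(ℝ, E) ∞ M] (k : ℕ) (φ : atlas E M) :
    PartialEquiv (HigherTangentBundle E k M) (Fin (k + 1) → E) where
  toFun := jetCoord k φ.1
  invFun p := HigherTangentBundle.mk k (chartCurve φ p)
  source := {u | u.proj ∈ φ.1.source}
  target := {p | p 0 ∈ φ.1.target}
  map_source' u hu := by
    induction u using Quotient.inductionOn with
    | h γ =>
      have hs : γ.1 0 ∈ φ.1.source := hu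
      change jetCoord k φ.1 (HigherTangentBundle.mk k γ) 0 ∈ φ.1.target
      rw [jetCoord_mk φ.2 hs, curveJet_zero]
      exact φ.1.map_source hs
  map_target' p hp := by
    change (HigherTangentBundle.mk k (chartCurve φ p)).proj ∈ φ.1.source
    rw [proj_mk, chartCurve_zero φ hp]
    exact φ.1.map_target hp
  left_inv' u hu := by
    induction u using Quotient.inductionOn with
    | h γ =>
      have hs : γ.1 0 ∈ φ.1.source := hu
      have hj : jetCoord k φ.1 (HigherTangentBundle.mk k γ) = curveJet k (φ.1 ∘ γ.1) :=
        jetCoord_mk φ.2 hs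
      have ht : curveJet k (φ.1 ∘ γ.1) 0 ∈ φ.1.target := by
        rw [curveJet_zero]; exact φ.1.map_source hs
      change HigherTangentBundle.mk k
        (chartCurve φ (jetCoord k φ.1 (HigherTangentBundle.mk k γ))) = HigherTangentBundle.mk k γ
      rw [hj, mk_eq_mk_iff]
      have h0 : (chartCurve φ (curveJet k (φ.1 ∘ γ.1))).1 0 = γ.1 0 := by
        rw [chartCurve_zero φ ht, curveJet_zero]
        exact φ.1.left_inv hs
      refine jetSetoid_r_of_chart h0 φ.2 (h0 ▸ hs) ?_
      rw [← jetCoord_mk φ.2 (h0 ▸ hs), jetCoord_chartCurve_self φ ht]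
  right_inv' p hp := jetCoord_chartCurve_self φ hp

theorem jetChart_symm_trans_source [IsManifold 𝓘(ℝ, E) ∞ M] (φ ψ : atlas E M) :
    ((jetChart k φ).symm.trans (jetChart k ψ)).source =
      {p | p 0 ∈ (φ.1.symm ≫ₕ ψ.1).source} := by
  ext p
  simp only [PartialEquiv.trans_source, PartialEquiv.symm_source, mem_inter_iff, mem_preimage,
    OpenPartialHomeomorph.trans_source, OpenPartialHomeomorph.symm_source, mem_ofPred_eq]
  refine and_congr_right fun hp => ?_
  have hp' : p 0 ∈ φ.1.target := hp
  change (chartCurve φ p).1 0 ∈ ψ.1.source ↔ _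
  rw [chartCurve_zero φ hp']

theorem contDiffOn_jetChart_transition [IsManifold 𝓘(ℝ, E) ∞ M] (φ ψ : atlas E M) :
    ContDiffOn ℝ ∞ ((jetChart k φ).symm.trans (jetChart k ψ))
      ((jetChart k φ).symm.trans (jetChart k ψ)).source := by
  rw [jetChart_symm_trans_source]
  have hτ : ContDiffOn ℝ ∞ (ψ.1 ∘ φ.1.symm) (φ.1.symm ≫ₕ ψ.1).source := fun x hx =>
    (contDiffAt_chart_comp_symm (g := id) contMDiff_id φ.2 ψ.2 hx.1 hx.2).contDiffWithinAt
  refine (contDiffOn_curveJet_comp_polyCurve (φ.1.symm ≫ₕ ψ.1).open_source hτ).congr fun p hp => ?_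
  exact jetCoord_chartCurve φ hp.1 ψ hp.2

/-- The charts `φᵏ`, for `φ` in the atlas of `M`, as a charted space core. The preferred chart
at `u` is the one attached to the preferred chart of `M` at `πᵏ(u)`. -/
def jetCore (E : Type*) [NormedAddCommGroup E] [NormedSpace ℝ E] (k : ℕ)
    (M : Type*) [TopologicalSpace M] [ChartedSpace E M] [IsManifold 𝓘(ℝ, E) ∞ M] :
    ChartedSpaceCore (Fin (k + 1) → E) (HigherTangentBundle E k M) where
  atlas := range (jetChart k)
  chartAt u := jetChart k ⟨chartAt E u.proj, chart_mem_atlas E u.proj⟩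
  mem_chart_source u := mem_chart_source E u.proj
  chart_mem_atlas u := mem_range_self _
  open_source := by
    rintro _ _ ⟨φ, rfl⟩ ⟨ψ, rfl⟩
    rw [jetChart_symm_trans_source]
    exact (φ.1.symm ≫ₕ ψ.1).open_source.preimage (continuous_apply 0)
  continuousOn_toFun := by
    rintro _ _ ⟨φ, rfl⟩ ⟨ψ, rfl⟩
    exact (contDiffOn_jetChart_transition φ ψ).continuousOn

instance [IsManifold 𝓘(ℝ, E) ∞ M] : TopologicalSpace (HigherTangentBundle E k M) :=
  (jetCore E k M).toTopologicalSpace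

instance [IsManifold 𝓘(ℝ, E) ∞ M] :
    ChartedSpace (Fin (k + 1) → E) (HigherTangentBundle E k M) :=
  (jetCore E k M).toChartedSpace

instance [IsManifold 𝓘(ℝ, E) ∞ M] :
    IsManifold 𝓘(ℝ, Fin (k + 1) → E) ∞ (HigherTangentBundle E k M) := by
  refine isManifold_of_contDiffOn _ _ _ ?_
  intro e e' he he'
  obtain ⟨c, ⟨φ, rfl⟩, he⟩ : ∃ c, ∃ hc : c ∈ (jetCore E k M).atlas,
      e = (jetCore E k M).openPartialHomeomorph c hc := by
    simpa using mem_iUnion₂.1 he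
  obtain ⟨c', ⟨ψ, rfl⟩, he'⟩ : ∃ c, ∃ hc : c ∈ (jetCore E k M).atlas,
      e' = (jetCore E k M).openPartialHomeomorph c hc := by
    simpa using mem_iUnion₂.1 he'
  subst he he'
  simp only [modelWithCornersSelf_coe, modelWithCornersSelf_coe_symm, preimage_id, range_id,
    inter_univ, Function.id_comp, Function.comp_id]
  exact contDiffOn_jetChart_transition (k := k) φ ψ

/-- The `k`-th order differential `Tᵏg([γ, x]ₖ) = [g ∘ γ, g(x)]ₖ` of a smooth map `g`. -/
def higherTangentMap [IsManifold 𝓘(ℝ, E) ∞ M] [IsManifold 𝓘(ℝ, E') ∞ N] (k : ℕ) (g : M → N)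
    (hg : ContMDiff 𝓘(ℝ, E) 𝓘(ℝ, E') ∞ g) (u : HigherTangentBundle E k M) :
    HigherTangentBundle E' k N :=
  Quotient.lift (s := jetSetoid E k M)
    (fun γ : SmoothCurve E M => HigherTangentBundle.mk k ⟨g ∘ γ.1, γ.2.comp hg⟩)
    (fun γ δ h => by
      have h' := jetSetoid_r_iff.1 h
      refine mk_eq_mk_iff.2 (jetSetoid_r_iff.2 ⟨congrArg g h'.1, fun ψ hψ hs => ?_⟩)
      exact curveJet_map_eq k hg (chart_mem_atlas E (γ.1 0)) hψ γ.2 δ.2 h'.1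
        (mem_chart_source E (γ.1 0)) hs
        (h'.2 _ (chart_mem_atlas E (γ.1 0)) (mem_chart_source E (γ.1 0)))) u

end Bundle

/-! ### Connection maps on `TᵏM` -/

section ConnectionMap

variable {E : Type*} [NormedAddCommGroup E] [NormedSpace ℝ E] {k : ℕ}
  {E' : Type*} [NormedAddCommGroup E'] [NormedSpace ℝ E']
  {M : Type*} [TopologicalSpace M] [ChartedSpace E M] [IsManifold 𝓘(ℝ, E) ∞ M]
  {N : Type*} [TopologicalSpace N] [ChartedSpace E' N] [IsManifold 𝓘(ℝ, E') ∞ N]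

/-- A fibrewise continuous linear map `T TᵏM → ⊕ᵢ₌₁ᵏ TM` over `πᵏ : TᵏM → M`. The component that is
usually called `Kⁱ`, `1 ≤ i ≤ k`, has index `i - 1` in `Fin k`. -/
abbrev FiberMap (E : Type*) [NormedAddCommGroup E] [NormedSpace ℝ E] (k : ℕ)
    (M : Type*) [TopologicalSpace M] [ChartedSpace E M] [IsManifold 𝓘(ℝ, E) ∞ M] : Type _ :=
  ∀ u : HigherTangentBundle E k M,
    TangentSpace 𝓘(ℝ, Fin (k + 1) → E) u →L[ℝ] (Fin k → TangentSpace 𝓘(ℝ, E) u.proj)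

/-- The `i`-th component of a fibre map as a map of total spaces `T TᵏM → TM`. -/
def FiberMap.total (K : FiberMap E k M) (i : Fin k)
    (v : TangentBundle 𝓘(ℝ, Fin (k + 1) → E) (HigherTangentBundle E k M)) :
    TangentBundle 𝓘(ℝ, E) M :=
  ⟨v.proj.proj, K v.proj v.2 i⟩

/-- `(y, η₁, …, ηₖ) ↦ (0, y, η₁, …, ηₖ₋₁)`. -/
def shift (E : Type*) [NormedAddCommGroup E] [NormedSpace ℝ E] (k : ℕ) :
    (Fin (k + 1) → E) →L[ℝ] (Fin (k + 1) → E) :=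
  ContinuousLinearMap.pi (Fin.cases 0 fun j => ContinuousLinearMap.proj j.castSucc)

/-- The endomorphism `𝕁` of `T TᵏM`. A tangent vector at `u` is given in Mathlib by its coordinates
`(y, η₁, …, ηₖ)` in the preferred chart at `u`, which is the chart `φᵏ` for the preferred chart `φ`
of `M` at `πᵏ(u)`. -/
def vertEndo (u : HigherTangentBundle E k M) :
    TangentSpace 𝓘(ℝ, Fin (k + 1) → E) u →L[ℝ] TangentSpace 𝓘(ℝ, Fin (k + 1) → E) u :=
  shift E k

/-- `K` is a connection map on `TᵏM`: a smooth vector bundle morphism `T TᵏM → ⊕ᵢ₌₁ᵏ TM` with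
`Kᵏ ∘ 𝕁ᵃ = Kᵏ⁻ᵃ` for `1 ≤ a ≤ k - 1` and `Kᵏ ∘ 𝕁ᵏ = (πᵏ)_*`. -/
structure IsConnectionMap (K : FiberMap E k M) : Prop where
  smooth : ∀ i, ContMDiff (𝓘(ℝ, Fin (k + 1) → E).tangent) (𝓘(ℝ, E).tangent) ∞ (K.total i)
  comp_vertEndo : ∀ (a : ℕ) (i l : Fin k), (l : ℕ) + 1 = k → 1 ≤ a → (i : ℕ) + 1 + a = k →
    ∀ u v, K u ((vertEndo u ^ a) v) l = K u v i
  comp_vertEndo_last : ∀ l : Fin k, (l : ℕ) + 1 = k → ∀ u v,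
    K u ((vertEndo u ^ k) v) l =
      mfderiv 𝓘(ℝ, Fin (k + 1) → E) 𝓘(ℝ, E) HigherTangentBundle.proj u v

/-- In the chart `φ` of `M`, the fibre map `K` has the local components `Cⁱ`, `1 ≤ i ≤ k`, where
`C⁰ = id` and `Cⁱ` is a function of `(x, ξ₁, …, ξᵢ)`: if `(x, ξ₁, …, ξₖ) = φᵏ(u)` and
`(η₀, η₁, …, ηₖ) = Tφᵏ(v)`, then
`Tφ(Kⁱ(v)) = ηᵢ + C¹(x, ξ₁) ηᵢ₋₁ + ⋯ + Cⁱ(x, ξ₁, …, ξᵢ) η₀`. -/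
def HasLocalComponents (K : FiberMap E k M) (φ : OpenPartialHomeomorph M E)
    (C : (i : ℕ) → (Fin (i + 1) → E) → E →L[ℝ] E) : Prop :=
  ∀ u : HigherTangentBundle E k M, u.proj ∈ φ.source →
    ∀ (v : TangentSpace 𝓘(ℝ, Fin (k + 1) → E) u) (i : Fin k),
      mfderiv 𝓘(ℝ, E) 𝓘(ℝ, E) φ u.proj (K u v i) =
        ∑ j : Fin (i + 2),
          C j (fun l : Fin (j + 1) => jetCoord k φ u ⟨l, by omega⟩)
            (mfderiv 𝓘(ℝ, Fin (k + 1) → E) 𝓘(ℝ, Fin (k + 1) → E) (jetCoord k φ) u v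
              ⟨i + 1 - j, by omega⟩)

/-- `K_M` and `K_N` are `g`-related: `K_N ∘ T Tᵏg = (⊕ᵢ₌₁ᵏ Tg) ∘ K_M`. -/
def AreRelated (g : M → N) (hg : ContMDiff 𝓘(ℝ, E) 𝓘(ℝ, E') ∞ g)
    (KM : FiberMap E k M) (KN : FiberMap E' k N) : Prop :=
  ∀ i : Fin k,
    KN.total i ∘
        tangentMap 𝓘(ℝ, Fin (k + 1) → E) 𝓘(ℝ, Fin (k + 1) → E') (higherTangentMap k g hg) =
      tangentMap 𝓘(ℝ, E) 𝓘(ℝ, E') g ∘ KM.total i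

/-! ### Linear connections and their lifts -/

/-- A smooth linear connection on `M`, given by its Christoffel symbols: for every chart `φ` of the
atlas a smooth family `Γ_φ(x)(ξ, y)`, `x` in the range of `φ`, of continuous bilinear maps, with the
usual transformation rule
`dτ(x)[Γ_φ(x)(ξ, y)] = d²τ(x)(ξ, y) + Γ_ψ(τ x)(dτ(x) ξ, dτ(x) y)`, `τ = ψ ∘ φ⁻¹`. -/
structure LinearConnection (E : Type*) [NormedAddCommGroup E] [NormedSpace ℝ E]
    (M : Type*) [TopologicalSpace M] [ChartedSpace E M] where
  christoffel : OpenPartialHomeomorph M E → E → E →L[ℝ] E →L[ℝ] E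
  smooth : ∀ φ ∈ atlas E M, ContDiffOn ℝ ∞ (christoffel φ) φ.target
  transform : ∀ φ ∈ atlas E M, ∀ ψ ∈ atlas E M, ∀ x ∈ (φ.symm ≫ₕ ψ).source, ∀ ξ y : E,
    fderiv ℝ (ψ ∘ φ.symm) x (christoffel φ x ξ y) =
      fderiv ℝ (fderiv ℝ (ψ ∘ φ.symm)) x ξ y +
        christoffel ψ (ψ (φ.symm x)) (fderiv ℝ (ψ ∘ φ.symm) x ξ) (fderiv ℝ (ψ ∘ φ.symm) x y)

/-- The local components `Mⁱ(x, ξ₁, …, ξᵢ)` of the lift of a linear connection with Christoffel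
symbol `Γ`: `M⁰ = id`, `M¹(x, ξ₁) y = Γ(x)(ξ₁, y)` and, for `i ≥ 2`,
`Mⁱ(x, ξ₁, …, ξᵢ) y = 1/i (∑ⱼ₌₁ⁱ ∂ⱼ Mⁱ⁻¹(x, ξ₁, …, ξᵢ₋₁)(y, j ξⱼ) + M¹(x, ξ₁) Mⁱ⁻¹(x, ξ₁, …, ξᵢ₋₁) y)`,
where `∂ⱼ` is the partial derivative in the `j`-th of the variables `x, ξ₁, …, ξᵢ₋₁`. -/
def liftComponent (Γ : E → E →L[ℝ] E →L[ℝ] E) : (i : ℕ) → (Fin (i + 1) → E) → E →L[ℝ] E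
  | 0 => fun _ => ContinuousLinearMap.id ℝ E
  | 1 => fun u => Γ (u 0) (u 1)
  | i + 2 => fun u =>
    (1 / ((i : ℝ) + 2)) •
      ((∑ j : Fin (i + 2), fderiv ℝ (liftComponent Γ (i + 1)) (fun l => u l.castSucc)
          (Pi.single j (((j : ℝ) + 1) • u j.succ))) +
        (Γ (u 0) (u 1)).comp (liftComponent Γ (i + 1) (fun l => u l.castSucc)))

/-- The map `T TᵏM → ⊕ᵢ₌₁ᵏ TM` induced by a linear connection: in the chart `φᵏ`,
`Kⁱ(u; η₀, η₁, …, ηₖ) = (x, ηᵢ + M¹(x, ξ₁) ηᵢ₋₁ + ⋯ + Mⁱ(x, ξ₁, …, ξᵢ) η₀)` with the local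
components `Mʲ = liftComponent (Γ_φ) j`. At `u` the formula is evaluated in the preferred chart `φ`
of `M` at `x = πᵏ(u)`, in which Mathlib's tangent spaces `T_u TᵏM = Eᵏ⁺¹` and `T_x M = E` are
coordinatised. For `k = 1` this is the connection map `(x, ξ; y, η) ↦ (x, η + Γ(x)(ξ, y))` of the
linear connection itself. -/
def LinearConnection.lift (D : LinearConnection E M) (k : ℕ) : FiberMap E k M := fun u =>
  let φ := chartAt E u.proj
  let K : (Fin (k + 1) → E) →L[ℝ] (Fin k → E) := ContinuousLinearMap.pi fun i : Fin k =>
    ∑ j : Fin (i + 2),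
      (liftComponent (D.christoffel φ) j
        (fun l : Fin (j + 1) => jetCoord k φ u ⟨l, by omega⟩)).comp
          (ContinuousLinearMap.proj (R := ℝ) (φ := fun _ : Fin (k + 1) => E) ⟨i + 1 - j, by omega⟩)
  K

/-- The linear connections `∇_M` and `∇_N` are `g`-related: their connection maps
`K : T TM → TM` satisfy `K_N ∘ T Tg = Tg ∘ K_M`. -/
def LinearConnection.AreRelated (g : M → N) (hg : ContMDiff 𝓘(ℝ, E) 𝓘(ℝ, E') ∞ g)
    (DM : LinearConnection E M) (DN : LinearConnection E' N) : Prop :=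
  HigherTangent.AreRelated g hg (DM.lift 1) (DN.lift 1)

end ConnectionMap

end HigherTangent
end

/-! The lifted connection computes normalised iterated covariant derivatives. Let `γ` be a curve
with `k`-jet `u` and `Y` a vector field along `γ` with normalised jet `(y, η₁, …, ηₖ)`. Then the
local formula for `Kⁱ` at `(u; y, η)` is `∇ₜⁱ Y / i!` at time `0`, where `∇ₜ = d/dt + Γ(γ)(γ', ·)`.
Indeed the recursion for `Mⁱ`, read along `γ`, says `(i + 1) Mⁱ⁺¹ = d/dt Mⁱ + Γ(γ)(γ', ·) ∘ Mⁱ`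
(`hasDerivAt_liftAlong`), and the Leibniz rule turns this into `∇ₜ(∇ₜⁱ Y / i!) = (i + 1) ∇ₜⁱ⁺¹ Y /
(i + 1)!` (`hasDerivAt_covDerivAlong`).

If `τ` relates the Christoffel symbols, `dτ` intertwines the covariant derivatives along `γ` and `τ
∘ γ` (`covDerivAlong_map`). The differential of the jet map of `τ` sends the jet of `Y` to the jet
of `dτ(γ) Y` (`fderiv_jetMap`). As every `(u, η)` is a pair of jets of polynomial curves, the local
formula is natural under `τ` (`localSum_map`).

Naturality is used twice. For `τ` a change of charts, the transformation rule of the Christoffel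
symbols is the required relation, and the formula holds in every chart. For `τ` a representative of
`g`, the relation is extracted from the case `k = 1` of the connection maps, and naturality is the
`g`-relatedness for all `k`. The identities for `𝕁` are index shifts in the local formula. -/

noncomputable section

namespace HigherTangent

/-! ### Local theory: covariant derivatives along curves in normed spaces. -/

section LocalTheory

variable {E : Type*} [NormedAddCommGroup E] [NormedSpace ℝ E]
  {F : Type*} [NormedAddCommGroup F] [NormedSpace ℝ F]

/-- The normalised `k`-jet at time `t` of a curve. -/
def curveJetAt (k : ℕ) (f : ℝ → E) (t : ℝ) : Fin (k + 1) → E :=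
  fun j => ((j : ℕ).factorial : ℝ)⁻¹ • iteratedDeriv (j : ℕ) f t

theorem contDiffOn_iteratedDeriv_curve {U : Set ℝ} (hU : IsOpen U) {f : ℝ → E}
    (hf : ContDiffOn ℝ ∞ f U) (n : ℕ) : ContDiffOn ℝ ∞ (iteratedDeriv n f) U := by
  induction n with
  | zero => simpa using hf
  | succ n ih =>
    rw [iteratedDeriv_succ]
    exact ih.deriv_of_isOpen hU (by simp)

theorem hasDerivAt_iteratedDeriv {U : Set ℝ} (hU : IsOpen U) {f : ℝ → E}
    (hf : ContDiffOn ℝ ∞ f U) (n : ℕ) {t : ℝ} (ht : t ∈ U) :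
    HasDerivAt (iteratedDeriv n f) (iteratedDeriv (n + 1) f t) t := by
  rw [iteratedDeriv_succ]
  exact (((contDiffOn_iteratedDeriv_curve hU hf n).contDiffAt
    (hU.mem_nhds ht)).differentiableAt (by simp)).hasDerivAt

/-- With the factorial normalisation, differentiating a jet shifts it with weights `n + 1`. These
are the weights `j ξⱼ` in the recursion for `Mⁱ`. -/
theorem hasDerivAt_normalized_iteratedDeriv {U : Set ℝ} (hU : IsOpen U) {f : ℝ → E}
    (hf : ContDiffOn ℝ ∞ f U) (n : ℕ) {t : ℝ} (ht : t ∈ U) :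
    HasDerivAt (fun s => (n.factorial : ℝ)⁻¹ • iteratedDeriv n f s)
      (((n : ℝ) + 1) • ((n + 1).factorial : ℝ)⁻¹ • iteratedDeriv (n + 1) f t) t := by
  refine ((hasDerivAt_iteratedDeriv hU hf n ht).const_smul (n.factorial : ℝ)⁻¹).congr_deriv ?_
  rw [smul_smul]
  congr 1
  have : (n.factorial : ℝ) ≠ 0 := by positivity
  have : (n : ℝ) + 1 ≠ 0 := by positivity
  rw [Nat.factorial_succ]
  push_cast
  field_simp

theorem contDiffOn_liftComponent {Γ : E → E →L[ℝ] E →L[ℝ] E} {S : Set E} (hS : IsOpen S)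
    (hΓ : ContDiffOn ℝ ∞ Γ S) (i : ℕ) :
    ContDiffOn ℝ ∞ (liftComponent Γ i) {u | u 0 ∈ S} := by
  have hop (n : ℕ) : IsOpen {u : Fin (n + 1) → E | u 0 ∈ S} := hS.preimage (continuous_apply 0)
  have hΓ' (n : ℕ) : ContDiffOn ℝ ∞ (fun u : Fin (n + 2) → E => Γ (u 0) (u 1)) {u | u 0 ∈ S} :=
    (hΓ.comp (contDiff_apply ℝ E (0 : Fin (n + 2))).contDiffOn fun _ h => h).clm_apply
      (contDiff_apply ℝ E (1 : Fin (n + 2))).contDiffOn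
  induction i with
  | zero => exact contDiffOn_const
  | succ i ih =>
    cases i with
    | zero => exact hΓ' 0
    | succ i =>
      have hr : ContDiffOn ℝ ∞ (fun (u : Fin (i + 1 + 1 + 1) → E) (l : Fin (i + 1 + 1)) =>
          u l.castSucc) {u | u 0 ∈ S} := by fun_prop
      have hm : MapsTo (fun (u : Fin (i + 1 + 1 + 1) → E) (l : Fin (i + 1 + 1)) =>
          u l.castSucc) {u | u 0 ∈ S} {u | u 0 ∈ S} := fun u hu => hu
      have hd := (ih.fderiv_of_isOpen (m := ∞) (hop _) (by simp)).comp hr hm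
      have h1 : ContDiffOn ℝ ∞ (fun u : Fin (i + 1 + 1 + 1) → E =>
          ∑ j : Fin (i + 2), fderiv ℝ (liftComponent Γ (i + 1)) (fun l => u l.castSucc)
          (Pi.single j (((j : ℝ) + 1) • u j.succ))) {u | u 0 ∈ S} := by
        refine ContDiffOn.sum fun j _ => hd.clm_apply ?_
        have : ContDiff ℝ ∞ (fun u : Fin (i + 1 + 1 + 1) → E =>
            ContinuousLinearMap.single ℝ (fun _ : Fin (i + 2) => E) j
              (((j : ℝ) + 1) • u j.succ)) := by fun_prop
        exact this.contDiffOn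
      have h2 := (contDiffOn_const (c := 1 / ((i : ℝ) + 2))).smul
        (h1.add ((hΓ' _).clm_comp (ih.comp hr hm)))
      exact h2

/-- The local component `Mⁱ` along a curve `γ`. -/
def liftAlong (Γ : E → E →L[ℝ] E →L[ℝ] E) (γ : ℝ → E) (i : ℕ) (t : ℝ) : E →L[ℝ] E :=
  liftComponent Γ i (curveJetAt i γ t)

/-- The sum of partial derivatives in the recursion is the chain rule for `d/dt` of `Mⁱ` along the
jet of `γ`, so this is the recursion solved for that derivative. -/
theorem hasDerivAt_liftAlong {Γ : E → E →L[ℝ] E →L[ℝ] E} {S : Set E} (hS : IsOpen S)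
    (hΓ : ContDiffOn ℝ ∞ Γ S) {U : Set ℝ} (hU : IsOpen U) {γ : ℝ → E} (hγ : ContDiffOn ℝ ∞ γ U)
    (hm : MapsTo γ U S) (i : ℕ) {t : ℝ} (ht : t ∈ U) :
    HasDerivAt (liftAlong Γ γ i)
      (((i : ℝ) + 1) • liftAlong Γ γ (i + 1) t -
        (Γ (γ t) (deriv γ t)).comp (liftAlong Γ γ i t)) t := by
  have hJ0 (n : ℕ) : curveJetAt n γ t 0 = γ t := by simp [curveJetAt]
  have hJ1 (n : ℕ) : curveJetAt (n + 1) γ t 1 = deriv γ t := by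
    simp [curveJetAt, iteratedDeriv_one]
  cases i with
  -- `M¹` is not produced by the recursion, but the identity persists: `M⁰ = id` is constant and `M¹
  -- = Γ(γ)(γ', ·)`.
  | zero =>
    have : ((((0 : ℕ) : ℝ) + 1) • liftAlong Γ γ (0 + 1) t -
        (Γ (γ t) (deriv γ t)).comp (liftAlong Γ γ 0 t)) = 0 := by
      have h1 : liftAlong Γ γ (0 + 1) t = Γ (γ t) (deriv γ t) := by
        change Γ (curveJetAt 1 γ t 0) (curveJetAt 1 γ t 1) = _
        rw [hJ0, hJ1]
      have h0 : liftAlong Γ γ 0 t = ContinuousLinearMap.id ℝ E := rfl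
      rw [h0, h1]
      simp
    rw [this]
    exact hasDerivAt_const _ _
  | succ i =>
    have hop : IsOpen {u : Fin (i + 1 + 1) → E | u 0 ∈ S} := hS.preimage (continuous_apply 0)
    have hmem : curveJetAt (i + 1) γ t ∈ {u : Fin (i + 1 + 1) → E | u 0 ∈ S} := by
      change curveJetAt (i + 1) γ t 0 ∈ S
      rw [hJ0]
      exact hm ht
    have hd := (((contDiffOn_liftComponent hS hΓ (i + 1)).contDiffAt
      (hop.mem_nhds hmem)).differentiableAt (by simp)).hasFDerivAt
    have hj : HasDerivAt (curveJetAt (i + 1) γ)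
        (fun j : Fin (i + 1 + 1) => ((j : ℝ) + 1) • curveJetAt (i + 2) γ t j.succ) t :=
      hasDerivAt_pi.2 fun j => hasDerivAt_normalized_iteratedDeriv hU hγ j ht
    refine (hd.comp_hasDerivAt t hj).congr_deriv ?_
    have hcast : (fun l : Fin (i + 2) => curveJetAt (i + 2) γ t l.castSucc) =
        curveJetAt (i + 1) γ t := rfl
    have hstep : liftAlong Γ γ (i + 1 + 1) t = (1 / ((i : ℝ) + 2)) •
        ((∑ j : Fin (i + 2), fderiv ℝ (liftComponent Γ (i + 1)) (curveJetAt (i + 1) γ t)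
          (Pi.single j (((j : ℝ) + 1) • curveJetAt (i + 2) γ t j.succ))) +
        (Γ (γ t) (deriv γ t)).comp (liftAlong Γ γ (i + 1) t)) := by
      rw [← hJ0 (i + 2), ← hJ1 (i + 1)]
      rfl
    have hne : (i : ℝ) + 2 ≠ 0 := by positivity
    -- The factor `i + 2` cancels the `1 / (i + 2)` of the recursion, and the vectors supported in a
    -- single slot add up to the velocity of the jet.
    rw [hstep, smul_smul]
    push_cast
    rw [show ((i : ℝ) + 1 + 1) * (1 / ((i : ℝ) + 2)) = 1 by field_simp; ring, one_smul,
      add_sub_cancel_right, ← map_sum, Finset.univ_sum_single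
        (fun j : Fin (i + 2) => ((j : ℝ) + 1) • curveJetAt (i + 2) γ t j.succ)]

/-- The `i`-th normalised covariant derivative `∇ₜⁱ Y / i!` of a vector field `Y` along `γ`,
expressed through the local components of the lifted connection. -/
def covDerivAlong (Γ : E → E →L[ℝ] E →L[ℝ] E) (γ Y : ℝ → E) (i : ℕ) (t : ℝ) : E :=
  ∑ j ∈ Finset.range (i + 1),
    liftAlong Γ γ j t (((i - j).factorial : ℝ)⁻¹ • iteratedDeriv (i - j) Y t)

/-- By the Leibniz rule, `Mʲ` applied to the normalised derivative of order `i + 1 - j` appears with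
weight `j` from differentiating `Mʲ⁻¹` and weight `i + 1 - j` from differentiating the jet of `Y`:
in total `i + 1`, independently of `j`. -/
theorem hasDerivAt_covDerivAlong {Γ : E → E →L[ℝ] E →L[ℝ] E} {S : Set E} (hS : IsOpen S)
    (hΓ : ContDiffOn ℝ ∞ Γ S) {U : Set ℝ} (hU : IsOpen U) {γ Y : ℝ → E}
    (hγ : ContDiffOn ℝ ∞ γ U) (hY : ContDiffOn ℝ ∞ Y U)
    (hm : MapsTo γ U S) (i : ℕ) {t : ℝ} (ht : t ∈ U) :
    HasDerivAt (covDerivAlong Γ γ Y i)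
      (((i : ℝ) + 1) • covDerivAlong Γ γ Y (i + 1) t -
        Γ (γ t) (deriv γ t) (covDerivAlong Γ γ Y i t)) t := by
  set y : ℕ → E := fun n => (n.factorial : ℝ)⁻¹ • iteratedDeriv n Y t with hy
  have hterm (j : ℕ) : HasDerivAt
      (fun s => liftAlong Γ γ j s (((i - j).factorial : ℝ)⁻¹ • iteratedDeriv (i - j) Y s))
      ((((j : ℝ) + 1) • liftAlong Γ γ (j + 1) t -
        (Γ (γ t) (deriv γ t)).comp (liftAlong Γ γ j t)) (y (i - j)) +
        liftAlong Γ γ j t ((((i - j : ℕ) : ℝ) + 1) • y (i - j + 1))) t :=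
    (hasDerivAt_liftAlong hS hΓ hU hγ hm j ht).clm_apply
      (hasDerivAt_normalized_iteratedDeriv hU hY (i - j) ht)
  refine (HasDerivAt.fun_sum fun j (_ : j ∈ Finset.range (i + 1)) => hterm j).congr_deriv ?_
  have e1 : ∑ j ∈ Finset.range (i + 1), ((((j : ℝ) + 1) • liftAlong Γ γ (j + 1) t -
        (Γ (γ t) (deriv γ t)).comp (liftAlong Γ γ j t)) (y (i - j)) +
        liftAlong Γ γ j t ((((i - j : ℕ) : ℝ) + 1) • y (i - j + 1))) =
      (∑ j ∈ Finset.range (i + 1), ((j : ℝ) + 1) • liftAlong Γ γ (j + 1) t (y (i - j)) +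
      ∑ j ∈ Finset.range (i + 1), ((i : ℝ) + 1 - j) • liftAlong Γ γ j t (y (i + 1 - j))) -
      Γ (γ t) (deriv γ t) (covDerivAlong Γ γ Y i t) := by
    rw [covDerivAlong, map_sum, ← Finset.sum_add_distrib, ← Finset.sum_sub_distrib]
    refine Finset.sum_congr rfl fun j hj => ?_
    have hji : j ≤ i := Nat.lt_succ_iff.1 (Finset.mem_range.1 hj)
    rw [show i + 1 - j = i - j + 1 by omega, Nat.cast_sub hji,
      show (i : ℝ) - j + 1 = i + 1 - j by ring]
    simp only [sub_apply, smul_apply,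
      ContinuousLinearMap.comp_apply, map_smul]
    simp only [hy, map_smul]
    abel
  rw [e1]
  congr 1
  -- Both sums are extended to the same range at no cost: the added term `j = 0` here, and `j = i +
  -- 1` in `e3`, has weight zero.
  have e2 : ∑ j ∈ Finset.range (i + 1), ((j : ℝ) + 1) • liftAlong Γ γ (j + 1) t (y (i - j)) =
      ∑ j ∈ Finset.range (i + 2), (j : ℝ) • liftAlong Γ γ j t (y (i + 1 - j)) := by
    rw [Finset.sum_range_succ' _ (i + 1)]
    simp
  have e3 : ∑ j ∈ Finset.range (i + 1), ((i : ℝ) + 1 - j) • liftAlong Γ γ j t (y (i + 1 - j)) =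
      ∑ j ∈ Finset.range (i + 2), ((i : ℝ) + 1 - j) • liftAlong Γ γ j t (y (i + 1 - j)) := by
    rw [Finset.sum_range_succ _ (i + 1)]
    simp
  rw [e2, e3, ← Finset.sum_add_distrib, covDerivAlong, Finset.smul_sum]
  refine Finset.sum_congr rfl fun j _ => ?_
  rw [← add_smul]
  congr 1
  ring

/-- `τ` relates the Christoffel symbols `Γ` and `Γ'` at `x`. -/
def ChristoffelRelatedAt (τ : E → F) (Γ : E → E →L[ℝ] E →L[ℝ] E) (Γ' : F → F →L[ℝ] F →L[ℝ] F)
    (x : E) : Prop :=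
  ∀ ξ y : E, fderiv ℝ τ x (Γ x ξ y) =
    fderiv ℝ (fderiv ℝ τ) x ξ y + Γ' (τ x) (fderiv ℝ τ x ξ) (fderiv ℝ τ x y)

/-- Induction on the order. Differentiating `dτ(γ)` produces a `d²τ` term, which the relation
between `Γ` and `Γ'` absorbs. -/
theorem covDerivAlong_map {Γ : E → E →L[ℝ] E →L[ℝ] E} {S : Set E} (hS : IsOpen S)
    (hΓ : ContDiffOn ℝ ∞ Γ S) {Γ' : F → F →L[ℝ] F →L[ℝ] F} {S' : Set F} (hS' : IsOpen S')
    (hΓ' : ContDiffOn ℝ ∞ Γ' S') {τ : E → F} (hτ : ContDiffOn ℝ ∞ τ S) (hτm : MapsTo τ S S')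
    (hrel : ∀ x ∈ S, ChristoffelRelatedAt τ Γ Γ' x) {U : Set ℝ} (hU : IsOpen U) {γ Y : ℝ → E}
    (hγ : ContDiffOn ℝ ∞ γ U) (hY : ContDiffOn ℝ ∞ Y U)
    (hm : MapsTo γ U S) (i : ℕ) {t : ℝ} (ht : t ∈ U) :
    covDerivAlong Γ' (τ ∘ γ) (fun s => fderiv ℝ τ (γ s) (Y s)) i t =
      fderiv ℝ τ (γ t) (covDerivAlong Γ γ Y i t) := by
  have hdτ : ContDiffOn ℝ ∞ (fderiv ℝ τ) S := hτ.fderiv_of_isOpen hS (by simp)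
  have hγ' : ContDiffOn ℝ ∞ (τ ∘ γ) U := hτ.comp hγ hm
  have hY' : ContDiffOn ℝ ∞ (fun s => fderiv ℝ τ (γ s) (Y s)) U := (hdτ.comp hγ hm).clm_apply hY
  induction i generalizing t with
  | zero => simp [covDerivAlong, liftAlong, liftComponent]
  | succ i ih =>
    have hSt := hS.mem_nhds (hm ht)
    have dγ : HasDerivAt γ (deriv γ t) t :=
      ((hγ.contDiffAt (hU.mem_nhds ht)).differentiableAt (by simp)).hasDerivAt
    have dτ : HasFDerivAt τ (fderiv ℝ τ (γ t)) (γ t) :=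
      ((hτ.contDiffAt hSt).differentiableAt (by simp)).hasFDerivAt
    have ddτ : HasFDerivAt (fderiv ℝ τ) (fderiv ℝ (fderiv ℝ τ) (γ t)) (γ t) :=
      ((hdτ.contDiffAt hSt).differentiableAt (by simp)).hasFDerivAt
    have dγ' : deriv (τ ∘ γ) t = fderiv ℝ τ (γ t) (deriv γ t) :=
      (dτ.comp_hasDerivAt t dγ).deriv
    have h1 := hasDerivAt_covDerivAlong hS' hΓ' hU hγ' hY' (hτm.comp hm) i ht
    have h2 := (ddτ.comp_hasDerivAt t dγ).clm_apply
      (hasDerivAt_covDerivAlong hS hΓ hU hγ hY hm i ht)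
    -- The induction hypothesis holds on all of the open set `U`, so both of its sides may be
    -- differentiated at `t`.
    have h3 := h1.unique (h2.congr_of_eventuallyEq
      (eventually_of_mem (hU.mem_nhds ht) fun s hs => ih hs))
    rw [dγ', ih ht, Function.comp_apply, Function.comp_apply, map_sub, map_smul,
      hrel _ (hm ht)] at h3
    have hne : (i : ℝ) + 1 ≠ 0 := by positivity
    refine smul_right_injective F hne ?_
    change ((i : ℝ) + 1) • _ = ((i : ℝ) + 1) • _
    have h4 := sub_eq_iff_eq_add.1 h3
    rw [h4]
    abel

/-- Parameter and time derivatives commute; each step of the induction is one use of the symmetry of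
the second derivative of `J`. -/
theorem fderiv_iteratedDeriv_comm {P : Type*} [NormedAddCommGroup P] [NormedSpace ℝ P]
    {W : Set (P × ℝ)} (hW : IsOpen W) {H : P × ℝ → F} (hH : ContDiffOn ℝ ∞ H W) (η : P) (n : ℕ)
    {q : P × ℝ} (hq : q ∈ W) :
    fderiv ℝ (fun q : P × ℝ => iteratedDeriv n (fun s => H (q.1, s)) q.2) q (η, 0) =
      iteratedDeriv n (fun s => fderiv ℝ H (q.1, s) (η, 0)) q.2 := by
  induction n generalizing q with
  | zero => simp
  | succ n ih =>
    set J : P × ℝ → F := fun q => iteratedDeriv n (fun s => H (q.1, s)) q.2 with hJ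
    have hJs : ContDiffOn ℝ ∞ J W := contDiffOn_iteratedDeriv hW hH n
    have hdJ : ContDiffOn ℝ ∞ (fderiv ℝ J) W := hJs.fderiv_of_isOpen hW (by simp)
    have hline (q : P × ℝ) : HasDerivAt (fun s : ℝ => ((q.1, s) : P × ℝ)) (0, 1) q.2 :=
      (hasDerivAt_const _ _).prodMk (hasDerivAt_id _)
    have e1 : (fun q : P × ℝ => iteratedDeriv (n + 1) (fun s => H (q.1, s)) q.2) =ᶠ[𝓝 q]
        fun q => fderiv ℝ J q (0, 1) := by
      filter_upwards [hW.mem_nhds hq] with p hp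
      rw [iteratedDeriv_succ]
      have hp' : HasFDerivAt J (fderiv ℝ J p) (p.1, p.2) :=
        ((hJs.contDiffAt (hW.mem_nhds hp)).differentiableAt (by simp)).hasFDerivAt
      exact (hp'.comp_hasDerivAt p.2 (hline p)).deriv
    have ddJ : HasFDerivAt (fderiv ℝ J) (fderiv ℝ (fderiv ℝ J) q) (q.1, q.2) :=
      ((hdJ.contDiffAt (hW.mem_nhds hq)).differentiableAt (by simp)).hasFDerivAt
    have ddJ' : HasFDerivAt (fderiv ℝ J) (fderiv ℝ (fderiv ℝ J) q) q := ddJ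
    rw [e1.fderiv_eq, (ddJ'.clm_apply (hasFDerivAt_const _ _)).fderiv, iteratedDeriv_succ]
    have e2 : (fun s => iteratedDeriv n (fun s => fderiv ℝ H (q.1, s) (η, 0)) s) =ᶠ[𝓝 q.2]
        fun s => fderiv ℝ J (q.1, s) (η, 0) := by
      have : (fun s : ℝ => ((q.1, s) : P × ℝ)) ⁻¹' W ∈ 𝓝 q.2 :=
        (hline q).continuousAt.preimage_mem_nhds (hW.mem_nhds hq)
      filter_upwards [this] with s hs
      exact (ih hs).symm
    have h2 : HasDerivAt (fun s => fderiv ℝ J (q.1, s) (η, 0)) _ q.2 :=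
      (ddJ.comp_hasDerivAt q.2 (hline q)).clm_apply (hasDerivAt_const q.2 (η, (0 : ℝ)))
    rw [e2.deriv_eq, h2.deriv]
    have hsymm := ((hJs.contDiffAt (hW.mem_nhds hq)).isSymmSndFDerivAt
      (by simpa using (WithTop.coe_le_coe.2 le_top : ((2 : ℕ∞) : ℕ∞ω) ≤ ∞))).eq (η, 0) (0, 1)
    simpa using hsymm

/-- The local representative of `Tᵏτ`. -/
def jetMap (k : ℕ) (τ : E → F) (p : Fin (k + 1) → E) : Fin (k + 1) → F :=
  curveJet k (τ ∘ polyCurve p)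

theorem jetMap_zero (k : ℕ) (τ : E → F) (p : Fin (k + 1) → E) : jetMap k τ p 0 = τ (p 0) := by
  simp [jetMap, curveJet_zero, polyCurve_zero]

/-- `polyCurve` is linear in its coefficients, so varying `u` in direction `η` varies the curve by
the field `polyCurve η`, and `τ` maps this to `dτ` of the field. Taking jets commutes with the
variation. -/
theorem fderiv_jetMap {k : ℕ} {τ : E → F} {S : Set E} (hS : IsOpen S) (hτ : ContDiffOn ℝ ∞ τ S)
    {u : Fin (k + 1) → E} (hu : u 0 ∈ S) (η : Fin (k + 1) → E) :
    fderiv ℝ (jetMap k τ) u η =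
      curveJet k (fun t => fderiv ℝ τ (polyCurve u t) (polyCurve η t)) := by
  set W : Set ((Fin (k + 1) → E) × ℝ) :=
    (fun q : (Fin (k + 1) → E) × ℝ => polyCurve q.1 q.2) ⁻¹' S with hWdef
  set H : (Fin (k + 1) → E) × ℝ → F := fun q => τ (polyCurve q.1 q.2) with hHdef
  have hW : IsOpen W := hS.preimage (contDiff_polyCurve_uncurry k).continuous
  have hH : ContDiffOn ℝ ∞ H W := hτ.comp (contDiff_polyCurve_uncurry k).contDiffOn fun _ h => h
  have huW : ((u, 0) : (Fin (k + 1) → E) × ℝ) ∈ W := by simpa [hWdef, polyCurve_zero] using hu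
  -- Both sides are the derivative at `s = 0` of `s ↦ τ (polyCurve (q.1 + s • η) q.2)`.
  have hHd {q : (Fin (k + 1) → E) × ℝ} (hq : q ∈ W) :
      fderiv ℝ H q (η, 0) = fderiv ℝ τ (polyCurve q.1 q.2) (polyCurve η q.2) := by
    have h1 : HasFDerivAt τ (fderiv ℝ τ (polyCurve q.1 q.2)) (polyCurve q.1 q.2) :=
      ((hτ.contDiffAt (hS.mem_nhds hq)).differentiableAt (by simp)).hasFDerivAt
    have h2 : HasDerivAt (fun s : ℝ => polyCurve (q.1 + s • η) q.2) (polyCurve η q.2) 0 := by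
      have e : (fun s : ℝ => polyCurve (q.1 + s • η) q.2) =
          fun s => polyCurve q.1 q.2 + s • polyCurve η q.2 := by
        funext s
        simp only [polyCurve, Finset.smul_sum, ← Finset.sum_add_distrib]
        refine Finset.sum_congr rfl fun j _ => ?_
        simp [smul_comm s]
      rw [e]
      simpa using ((hasDerivAt_id (0 : ℝ)).smul_const (polyCurve η q.2)).const_add
        (polyCurve q.1 q.2)
    have h3 : HasFDerivAt H (fderiv ℝ H q) q :=
      ((hH.contDiffAt (hW.mem_nhds hq)).differentiableAt (by simp)).hasFDerivAt
    have h4 : HasDerivAt (fun s : ℝ => ((q.1 + s • η, q.2) : (Fin (k + 1) → E) × ℝ)) (η, 0) 0 := by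
      have := ((hasDerivAt_id (0 : ℝ)).smul_const η).const_add q.1
      simpa using this.prodMk (hasDerivAt_const (0 : ℝ) q.2)
    have h5 := (HasFDerivAt.comp_hasDerivAt_of_eq (0 : ℝ) h3 h4 (by simp))
    have h6 := (HasFDerivAt.comp_hasDerivAt_of_eq (0 : ℝ) h1 h2 (by simp))
    exact h5.unique h6
  have hJ (n : ℕ) : ContDiffOn ℝ ∞ (fun q : (Fin (k + 1) → E) × ℝ =>
      iteratedDeriv n (fun s => H (q.1, s)) q.2) W := contDiffOn_iteratedDeriv hW hH n
  have hinj : HasFDerivAt (fun p : Fin (k + 1) → E => ((p, 0) : (Fin (k + 1) → E) × ℝ))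
      (ContinuousLinearMap.inl ℝ (Fin (k + 1) → E) ℝ) u := by
    exact (hasFDerivAt_id u).prodMk (hasFDerivAt_const (0 : ℝ) u)
  have hcomp (j : Fin (k + 1)) : HasFDerivAt (fun p => jetMap k τ p j)
      (((j : ℕ).factorial : ℝ)⁻¹ • (fderiv ℝ (fun q : (Fin (k + 1) → E) × ℝ =>
        iteratedDeriv j (fun s => H (q.1, s)) q.2) (u, 0)).comp
        (ContinuousLinearMap.inl ℝ (Fin (k + 1) → E) ℝ)) u := by
    have h := ((((hJ j).contDiffAt (hW.mem_nhds huW)).differentiableAt (by simp)).hasFDerivAt)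
    exact (h.comp u hinj).const_smul (((j : ℕ).factorial : ℝ)⁻¹)
  rw [(hasFDerivAt_pi.2 hcomp).fderiv]
  funext j
  simp only [ContinuousLinearMap.pi_apply, smul_apply,
    ContinuousLinearMap.comp_apply, ContinuousLinearMap.inl_apply, curveJet]
  rw [fderiv_iteratedDeriv_comm hW hH η j huW]
  congr 1
  refine Filter.EventuallyEq.iteratedDeriv_eq j ?_
  have : (fun s : ℝ => ((u, s) : (Fin (k + 1) → E) × ℝ)) ⁻¹' W ∈ 𝓝 (0 : ℝ) :=
    (by fun_prop : Continuous fun s : ℝ => ((u, s) : (Fin (k + 1) → E) × ℝ)).continuousAt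
      |>.preimage_mem_nhds (hW.mem_nhds huW)
  filter_upwards [this] with s hs
  exact hHd hs

/-- The right-hand side of the local formula for `Kⁱ⁺¹`. -/
def localSum {k : ℕ} (C : (i : ℕ) → (Fin (i + 1) → E) → E →L[ℝ] E) (u η : Fin (k + 1) → E)
    (i : Fin k) : E :=
  ∑ j : Fin (i + 2), C j (fun l : Fin (j + 1) => u ⟨l, by omega⟩) (η ⟨i + 1 - j, by omega⟩)

/-- The bridge from the algebraic formula to covariant derivatives. The shift `i + 1` appears
because index `i` of `Fin k` stands for `Kⁱ⁺¹`. -/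
theorem localSum_curveJet {k : ℕ} (Γ : E → E →L[ℝ] E →L[ℝ] E) (γ Y : ℝ → E) (i : Fin k) :
    localSum (liftComponent Γ) (curveJet k γ) (curveJet k Y) i =
      covDerivAlong Γ γ Y (i + 1) 0 := by
  rw [covDerivAlong, ← Fin.sum_univ_eq_sum_range (fun j => liftAlong Γ γ j 0
    (((i + 1 - j).factorial : ℝ)⁻¹ • iteratedDeriv (i + 1 - j) Y 0))]
  rfl

/-- Naturality of the local formula for the lifted connection. -/
theorem localSum_map {k : ℕ} {Γ : E → E →L[ℝ] E →L[ℝ] E} {S : Set E} (hS : IsOpen S)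
    (hΓ : ContDiffOn ℝ ∞ Γ S) {Γ' : F → F →L[ℝ] F →L[ℝ] F} {S' : Set F} (hS' : IsOpen S')
    (hΓ' : ContDiffOn ℝ ∞ Γ' S') {τ : E → F} (hτ : ContDiffOn ℝ ∞ τ S) (hτm : MapsTo τ S S')
    (hrel : ∀ x ∈ S, ChristoffelRelatedAt τ Γ Γ' x) {u : Fin (k + 1) → E} (hu : u 0 ∈ S)
    (η : Fin (k + 1) → E) (i : Fin k) :
    localSum (liftComponent Γ') (jetMap k τ u) (fderiv ℝ (jetMap k τ) u η) i =
      fderiv ℝ τ (u 0) (localSum (liftComponent Γ) u η i) := by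
  have hU : IsOpen (polyCurve u ⁻¹' S) := hS.preimage (contDiff_polyCurve u).continuous
  have h0 : (0 : ℝ) ∈ polyCurve u ⁻¹' S := by simpa [polyCurve_zero] using hu
  rw [fderiv_jetMap hS hτ hu, jetMap, localSum_curveJet]
  -- Arbitrary coordinates `u`, `η` are the jets of their own polynomial curves.
  conv_rhs => rw [← curveJet_polyCurve u, ← curveJet_polyCurve η, localSum_curveJet,
    curveJet_zero]
  exact covDerivAlong_map hS hΓ hS' hΓ' hτ hτm hrel hU (contDiff_polyCurve u).contDiffOn
    (contDiff_polyCurve η).contDiffOn (fun _ h => h) (i + 1) h0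

theorem contDiffOn_localSum {k : ℕ} {Γ : E → E →L[ℝ] E →L[ℝ] E} {S : Set E} (hS : IsOpen S)
    (hΓ : ContDiffOn ℝ ∞ Γ S) (i : Fin k) :
    ContDiffOn ℝ ∞ (fun q : (Fin (k + 1) → E) × (Fin (k + 1) → E) =>
      localSum (liftComponent Γ) q.1 q.2 i) {q | q.1 0 ∈ S} := by
  refine ContDiffOn.sum fun j _ => ContDiffOn.clm_apply ?_ (by fun_prop)
  refine (contDiffOn_liftComponent hS hΓ j).comp (f := fun
    (q : (Fin (k + 1) → E) × (Fin (k + 1) → E)) (l : Fin (j + 1)) => q.1 ⟨l, by omega⟩)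
    (by fun_prop) fun q hq => hq

theorem hasDerivAt_polyCurve_zero (u : Fin 2 → E) : HasDerivAt (polyCurve u) (u 1) 0 := by
  have h := ((contDiff_polyCurve u).differentiable (by simp) 0).hasDerivAt
  have h1 := iteratedDeriv_polyCurve u 1
  simp only [Fin.val_one, iteratedDeriv_one, Nat.factorial_one, Nat.cast_one, one_smul] at h1
  rwa [h1] at h

theorem jetMap_one_one {τ : E → F} {u : Fin 2 → E} (hτ : DifferentiableAt ℝ τ (u 0)) :
    jetMap 1 τ u 1 = fderiv ℝ τ (u 0) (u 1) := by
  have h := HasFDerivAt.comp_hasDerivAt_of_eq (0 : ℝ) hτ.hasFDerivAt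
    (hasDerivAt_polyCurve_zero u) (polyCurve_zero u).symm
  simp [jetMap, curveJet, iteratedDeriv_one, h.deriv]

/-- This is the source of the `d²τ` term in the relation of Christoffel symbols. -/
theorem fderiv_jetMap_one_one {τ : E → F} {S : Set E} (hS : IsOpen S) (hτ : ContDiffOn ℝ ∞ τ S)
    {u : Fin 2 → E} (hu : u 0 ∈ S) (η : Fin 2 → E) :
    fderiv ℝ (jetMap 1 τ) u η 1 = fderiv ℝ (fderiv ℝ τ) (u 0) (u 1) (η 0) +
      fderiv ℝ τ (u 0) (η 1) := by
  have hd : HasFDerivAt (fderiv ℝ τ) (fderiv ℝ (fderiv ℝ τ) (u 0)) (u 0) :=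
    ((((hτ.fderiv_of_isOpen (m := ∞) hS (by simp)).contDiffAt
      (hS.mem_nhds hu))).differentiableAt (by simp)).hasFDerivAt
  have h := (HasFDerivAt.comp_hasDerivAt_of_eq (0 : ℝ) hd (hasDerivAt_polyCurve_zero u)
    (polyCurve_zero u).symm).clm_apply (hasDerivAt_polyCurve_zero η)
  simp only [Function.comp_apply, polyCurve_zero] at h
  rw [fderiv_jetMap hS hτ hu]
  simp [curveJet, iteratedDeriv_one, h.deriv]

theorem fderiv_jetMap_apply_zero {k : ℕ} {τ : E → F} {S : Set E} (hS : IsOpen S)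
    (hτ : ContDiffOn ℝ ∞ τ S) {u : Fin (k + 1) → E} (hu : u 0 ∈ S) (η : Fin (k + 1) → E) :
    fderiv ℝ (jetMap k τ) u η 0 = fderiv ℝ τ (u 0) (η 0) := by
  rw [fderiv_jetMap hS hτ hu]
  simp [curveJet, polyCurve_zero]

theorem localSum_one (Γ : E → E →L[ℝ] E →L[ℝ] E) (u η : Fin 2 → E) :
    localSum (k := 1) (liftComponent Γ) u η 0 = η 1 + Γ (u 0) (u 1) (η 0) := by
  simp [localSum, Fin.sum_univ_succ, liftComponent]

/-- If the local formula for `k = 1` is natural, the Christoffel symbols are related. -/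
theorem ChristoffelRelatedAt.of_localSum {τ : E → F} {Γ : E → E →L[ℝ] E →L[ℝ] E}
    {Γ' : F → F →L[ℝ] F →L[ℝ] F} {S : Set E} (hS : IsOpen S) (hτ : ContDiffOn ℝ ∞ τ S) {x : E}
    (hx : x ∈ S)
    (h : ∀ u η : Fin 2 → E, u 0 = x →
      localSum (k := 1) (liftComponent Γ') (jetMap 1 τ u) (fderiv ℝ (jetMap 1 τ) u η) 0 =
        fderiv ℝ τ x (localSum (k := 1) (liftComponent Γ) u η 0)) :
    ChristoffelRelatedAt τ Γ Γ' x := by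
  intro ξ y
  have hd := (hτ.contDiffAt (hS.mem_nhds hx)).differentiableAt (by simp)
  -- With `η₁ = 0` the terms linear in `η₁` drop out on both sides, leaving exactly the Christoffel
  -- relation.
  have h1 := h ![x, ξ] ![y, 0] rfl
  rw [localSum_one, localSum_one, fderiv_jetMap_one_one hS hτ hx, jetMap_zero,
    jetMap_one_one hd, fderiv_jetMap_apply_zero hS hτ hx] at h1
  simpa using h1.symm

end LocalTheory

/-! ### Chart representatives of `g` and of `Tᵏg`. -/

section ChartDomain

variable {E E' M N : Type*} [TopologicalSpace E] [TopologicalSpace E'] [TopologicalSpace M]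
  [TopologicalSpace N]

/-- The domain of the representative `ψ ∘ g ∘ φ⁻¹` of `g`. -/
def chartDomain (g : M → N) (φ : OpenPartialHomeomorph M E) (ψ : OpenPartialHomeomorph N E') :
    Set E :=
  φ.target ∩ φ.symm ⁻¹' (g ⁻¹' ψ.source)

theorem isOpen_chartDomain {g : M → N} (hg : Continuous g) (φ : OpenPartialHomeomorph M E)
    (ψ : OpenPartialHomeomorph N E') : IsOpen (chartDomain g φ ψ) :=
  φ.isOpen_inter_preimage_symm (ψ.open_source.preimage hg)

theorem mapsTo_chartDomain (g : M → N) (φ : OpenPartialHomeomorph M E)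
    (ψ : OpenPartialHomeomorph N E') :
    MapsTo (ψ ∘ g ∘ φ.symm) (chartDomain g φ ψ) ψ.target := fun _ hx => ψ.map_source hx.2

theorem mem_chartDomain {g : M → N} {φ : OpenPartialHomeomorph M E}
    {ψ : OpenPartialHomeomorph N E'} {x : M} (hx : x ∈ φ.source) (hx' : g x ∈ ψ.source) :
    φ x ∈ chartDomain g φ ψ :=
  ⟨φ.map_source hx, by simpa [φ.left_inv hx] using hx'⟩

end ChartDomain

section JetCoord

variable {E : Type*} [NormedAddCommGroup E] [NormedSpace ℝ E] {k : ℕ}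
  {M : Type*} [TopologicalSpace M] [ChartedSpace E M]

theorem jetCoord_zero {φ : OpenPartialHomeomorph M E} (hφ : φ ∈ atlas E M)
    {u : HigherTangentBundle E k M} (hu : u.proj ∈ φ.source) : jetCoord k φ u 0 = φ u.proj := by
  induction u using Quotient.inductionOn with
  | h γ =>
    have hs : γ.1 0 ∈ φ.source := hu
    change jetCoord k φ (HigherTangentBundle.mk k γ) 0 = φ (γ.1 0)
    rw [jetCoord_mk hφ hs, curveJet_zero]
    rfl

end JetCoord

section JetCharts

variable {E : Type*} [NormedAddCommGroup E] [NormedSpace ℝ E] {k : ℕ}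
  {E' : Type*} [NormedAddCommGroup E'] [NormedSpace ℝ E']
  {M : Type*} [TopologicalSpace M] [ChartedSpace E M] [IsManifold 𝓘(ℝ, E) ∞ M]
  {N : Type*} [TopologicalSpace N] [ChartedSpace E' N] [IsManifold 𝓘(ℝ, E') ∞ N]

/-- The chart `φᵏ` of `TᵏM` as an open partial homeomorphism. -/
def jetOpenChart (k : ℕ) (φ : atlas E M) :
    OpenPartialHomeomorph (HigherTangentBundle E k M) (Fin (k + 1) → E) :=
  (jetCore E k M).openPartialHomeomorph (jetChart k φ) (mem_range_self φ)

theorem jetOpenChart_mem_atlas (φ : atlas E M) :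
    jetOpenChart k φ ∈ atlas (Fin (k + 1) → E) (HigherTangentBundle E k M) :=
  mem_iUnion₂.2 ⟨jetChart k φ, mem_range_self φ, rfl⟩

theorem isOpen_proj_preimage_source {φ : OpenPartialHomeomorph M E} (hφ : φ ∈ atlas E M) :
    IsOpen {u : HigherTangentBundle E k M | u.proj ∈ φ.source} :=
  (jetOpenChart k ⟨φ, hφ⟩).open_source

theorem contMDiffOn_jetCoord {φ : OpenPartialHomeomorph M E} (hφ : φ ∈ atlas E M) :
    ContMDiffOn 𝓘(ℝ, Fin (k + 1) → E) 𝓘(ℝ, Fin (k + 1) → E) ∞ (jetCoord k φ)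
      {u | u.proj ∈ φ.source} :=
  contMDiffOn_of_mem_maximalAtlas
    (IsManifold.subset_maximalAtlas (jetOpenChart_mem_atlas (k := k) ⟨φ, hφ⟩))

theorem contMDiffAt_jetCoord {φ : OpenPartialHomeomorph M E} (hφ : φ ∈ atlas E M)
    {u : HigherTangentBundle E k M} (hu : u.proj ∈ φ.source) :
    ContMDiffAt 𝓘(ℝ, Fin (k + 1) → E) 𝓘(ℝ, Fin (k + 1) → E) ∞ (jetCoord k φ) u :=
  (contMDiffOn_jetCoord hφ).contMDiffAt ((isOpen_proj_preimage_source hφ).mem_nhds hu)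

theorem contMDiff_proj :
    ContMDiff 𝓘(ℝ, Fin (k + 1) → E) 𝓘(ℝ, E) ∞
      (HigherTangentBundle.proj : HigherTangentBundle E k M → M) := by
  intro u
  set φ := chartAt E u.proj
  have hφ : φ ∈ atlas E M := chart_mem_atlas E u.proj
  have hu : u.proj ∈ φ.source := mem_chart_source E u.proj
  have h1 : ContMDiffAt 𝓘(ℝ, E) 𝓘(ℝ, E) ∞ φ.symm (jetCoord k φ u 0) :=
    contMDiffAt_symm_of_mem_maximalAtlas (IsManifold.subset_maximalAtlas hφ) (by
      rw [jetCoord_zero hφ hu]; exact φ.map_source hu)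
  have h2 : ContMDiffAt 𝓘(ℝ, Fin (k + 1) → E) 𝓘(ℝ, E) ∞
      (fun u : HigherTangentBundle E k M => jetCoord k φ u 0) u :=
    ((contDiff_apply ℝ E (0 : Fin (k + 1))).contMDiff _).comp u (contMDiffAt_jetCoord hφ hu)
  refine (h1.comp u h2).congr_of_eventuallyEq ?_
  filter_upwards [(isOpen_proj_preimage_source (k := k) hφ).mem_nhds hu] with w hw
  simp [jetCoord_zero hφ hw, φ.left_inv hw]

theorem eventually_mem_chart_sources {A B : Type*} [TopologicalSpace A] [TopologicalSpace B]
    {g : M → B} (hg : Continuous g)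
    (φ : OpenPartialHomeomorph M E) (ψ : OpenPartialHomeomorph B A)
    {u : HigherTangentBundle E k M} (hu : u.proj ∈ φ.source) (hu' : g u.proj ∈ ψ.source) :
    ∀ᶠ w : HigherTangentBundle E k M in 𝓝 u, w.proj ∈ φ.source ∧ g w.proj ∈ ψ.source :=
  Filter.inter_mem ((φ.open_source.preimage contMDiff_proj.continuous).mem_nhds hu)
    ((ψ.open_source.preimage (hg.comp contMDiff_proj.continuous)).mem_nhds hu')

theorem proj_higherTangentMap {g : M → N} (hg : ContMDiff 𝓘(ℝ, E) 𝓘(ℝ, E') ∞ g)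
    (u : HigherTangentBundle E k M) : (higherTangentMap k g hg u).proj = g u.proj := by
  induction u using Quotient.inductionOn with
  | h γ => rfl

theorem higherTangentMap_id :
    higherTangentMap k (id : M → M) contMDiff_id = (id : HigherTangentBundle E k M → _) := by
  funext u
  induction u using Quotient.inductionOn with
  | h γ => rfl

/-- In the chart, a curve and the polynomial curve built from its jet have the same `k`-jet, hence
so do their images under the representative of `g`. -/
theorem jetCoord_higherTangentMap {g : M → N} (hg : ContMDiff 𝓘(ℝ, E) 𝓘(ℝ, E') ∞ g)
    {φ : OpenPartialHomeomorph M E} (hφ : φ ∈ atlas E M) {ψ : OpenPartialHomeomorph N E'}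
    (hψ : ψ ∈ atlas E' N) {u : HigherTangentBundle E k M} (hu : u.proj ∈ φ.source)
    (hu' : g u.proj ∈ ψ.source) :
    jetCoord k ψ (higherTangentMap k g hg u) = jetMap k (ψ ∘ g ∘ φ.symm) (jetCoord k φ u) := by
  induction u using Quotient.inductionOn with
  | h γ =>
    have hs : γ.1 0 ∈ φ.source := hu
    have hs' : g (γ.1 0) ∈ ψ.source := hu'
    change jetCoord k ψ (HigherTangentBundle.mk k ⟨g ∘ γ.1, γ.2.comp hg⟩) =
      jetMap k (ψ ∘ g ∘ φ.symm) (jetCoord k φ (HigherTangentBundle.mk k γ))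
    rw [jetCoord_mk hψ hs', jetCoord_mk hφ hs, jetMap]
    change curveJet k (ψ ∘ g ∘ γ.1) = _
    have hc := contDiffAt_chart_comp_curve γ.2 hφ hs
    rw [curveJet_congr (chart_comp_eventuallyEq γ.2.contMDiffAt.continuousAt g φ ψ hs)]
    exact curveJet_comp_eq (contDiffAt_chart_comp_symm hg hφ hψ (φ.map_source hs)
      (by simpa [φ.left_inv hs] using hs')) hc (contDiff_polyCurve _).contDiffAt
      (curveJet_polyCurve _).symm

theorem contDiffOn_chartDomain {g : M → N} (hg : ContMDiff 𝓘(ℝ, E) 𝓘(ℝ, E') ∞ g)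
    {φ : OpenPartialHomeomorph M E} (hφ : φ ∈ atlas E M) {ψ : OpenPartialHomeomorph N E'}
    (hψ : ψ ∈ atlas E' N) : ContDiffOn ℝ ∞ (ψ ∘ g ∘ φ.symm) (chartDomain g φ ψ) := fun _ hx =>
  (contDiffAt_chart_comp_symm hg hφ hψ hx.1 hx.2).contDiffWithinAt

theorem contMDiff_higherTangentMap {g : M → N} (hg : ContMDiff 𝓘(ℝ, E) 𝓘(ℝ, E') ∞ g) :
    ContMDiff 𝓘(ℝ, Fin (k + 1) → E) 𝓘(ℝ, Fin (k + 1) → E') ∞ (higherTangentMap k g hg) := by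
  intro u
  set φ := chartAt E u.proj
  have hφ : φ ∈ atlas E M := chart_mem_atlas E u.proj
  have hu : u.proj ∈ φ.source := mem_chart_source E u.proj
  set ψ := chartAt E' (g u.proj)
  have hψ : ψ ∈ atlas E' N := chart_mem_atlas E' (g u.proj)
  have hu' : g u.proj ∈ ψ.source := mem_chart_source E' (g u.proj)
  have hτ := contDiffOn_chartDomain hg hφ hψ
  have hS := isOpen_chartDomain hg.continuous φ ψ
  have h0 : jetCoord k φ u 0 ∈ chartDomain g φ ψ := by
    rw [jetCoord_zero hφ hu]; exact mem_chartDomain hu hu'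
  have hj : ContDiffAt ℝ ∞ (jetMap k (ψ ∘ g ∘ φ.symm)) (jetCoord k φ u) :=
    (contDiffOn_curveJet_comp_polyCurve hS hτ).contDiffAt
      ((hS.preimage (continuous_apply 0)).mem_nhds h0)
  have h1 : ContMDiffAt 𝓘(ℝ, Fin (k + 1) → E') 𝓘(ℝ, Fin (k + 1) → E') ∞
      (jetOpenChart k ⟨ψ, hψ⟩).symm (jetMap k (ψ ∘ g ∘ φ.symm) (jetCoord k φ u)) :=
    contMDiffAt_symm_of_mem_maximalAtlas
      (IsManifold.subset_maximalAtlas (jetOpenChart_mem_atlas (k := k) ⟨ψ, hψ⟩)) (by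
        change jetMap k (ψ ∘ g ∘ φ.symm) (jetCoord k φ u) 0 ∈ ψ.target
        rw [jetMap_zero]
        exact mapsTo_chartDomain g φ ψ h0)
  refine (h1.comp u (hj.contMDiffAt.comp u (contMDiffAt_jetCoord hφ hu))).congr_of_eventuallyEq ?_
  have hnear := eventually_mem_chart_sources (k := k) hg.continuous φ ψ hu hu'
  filter_upwards [hnear] with w hw
  have hw' : higherTangentMap k g hg w ∈ (jetOpenChart k ⟨ψ, hψ⟩).source := by
    change (higherTangentMap k g hg w).proj ∈ ψ.source
    rw [proj_higherTangentMap]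
    exact hw.2
  simp only [Function.comp_apply]
  rw [← jetCoord_higherTangentMap hg hφ hψ hw.1 hw.2]
  exact ((jetOpenChart k ⟨ψ, hψ⟩).left_inv hw').symm

theorem mfderiv_chartAt_self (x : M) (w : TangentSpace 𝓘(ℝ, E) x) :
    mfderiv 𝓘(ℝ, E) 𝓘(ℝ, E) (chartAt E x) x w = w := by
  have h := mfderiv_extChartAt_self (I := 𝓘(ℝ, E)) (x := x)
  simp only [mfld_simps] at h
  rw [h]
  rfl

/-- The preferred chart of `TᵏM` at `u` is by construction `jetCoord` of the preferred chart of `M`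
at `u.proj`. -/
theorem mfderiv_jetCoord_chartAt_self (u : HigherTangentBundle E k M)
    (w : TangentSpace 𝓘(ℝ, Fin (k + 1) → E) u) :
    mfderiv 𝓘(ℝ, Fin (k + 1) → E) 𝓘(ℝ, Fin (k + 1) → E) (jetCoord k (chartAt E u.proj)) u w = w :=
  mfderiv_chartAt_self u w

theorem fderiv_chart_mfderiv {g : M → N} (hg : ContMDiff 𝓘(ℝ, E) 𝓘(ℝ, E') ∞ g)
    {φ : OpenPartialHomeomorph M E} (hφ : φ ∈ atlas E M) {ψ : OpenPartialHomeomorph N E'}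
    (hψ : ψ ∈ atlas E' N) {x : M} (hx : x ∈ φ.source) (hx' : g x ∈ ψ.source)
    (w : TangentSpace 𝓘(ℝ, E) x) :
    fderiv ℝ (ψ ∘ g ∘ φ.symm) (φ x) (mfderiv 𝓘(ℝ, E) 𝓘(ℝ, E) φ x w) =
      mfderiv 𝓘(ℝ, E') 𝓘(ℝ, E') ψ (g x) (mfderiv 𝓘(ℝ, E) 𝓘(ℝ, E') g x w) := by
  have hφx : MDifferentiableAt 𝓘(ℝ, E) 𝓘(ℝ, E) φ x := mdifferentiableAt_atlas hφ hx
  have hψx : MDifferentiableAt 𝓘(ℝ, E') 𝓘(ℝ, E') ψ (g x) := mdifferentiableAt_atlas hψ hx'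
  have hτ : MDifferentiableAt 𝓘(ℝ, E) 𝓘(ℝ, E') (ψ ∘ g ∘ φ.symm) (φ x) :=
    ((contDiffAt_chart_comp_symm hg hφ hψ (φ.map_source hx)
      (by simpa [φ.left_inv hx] using hx')).differentiableAt (by simp)).mdifferentiableAt
  have e : (ψ ∘ g ∘ φ.symm) ∘ φ =ᶠ[𝓝 x] ψ ∘ g := by
    filter_upwards [φ.open_source.mem_nhds hx] with y hy
    simp [φ.left_inv hy]
  have h1 := e.mfderiv_eq (I := 𝓘(ℝ, E)) (I' := 𝓘(ℝ, E'))
  rw [mfderiv_comp x hτ hφx, mfderiv_comp x hψx ((hg x).mdifferentiableAt (by simp)),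
    mfderiv_eq_fderiv] at h1
  exact congrArg (fun L : E →L[ℝ] E' => L w) h1

/-- The chain rule applied to `jetCoord_higherTangentMap`, which holds on a neighbourhood of `u`. -/
theorem mfderiv_jetCoord_higherTangentMap {g : M → N} (hg : ContMDiff 𝓘(ℝ, E) 𝓘(ℝ, E') ∞ g)
    {φ : OpenPartialHomeomorph M E} (hφ : φ ∈ atlas E M) {ψ : OpenPartialHomeomorph N E'}
    (hψ : ψ ∈ atlas E' N) {u : HigherTangentBundle E k M} (hu : u.proj ∈ φ.source)
    (hu' : g u.proj ∈ ψ.source) (w : TangentSpace 𝓘(ℝ, Fin (k + 1) → E) u) :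
    mfderiv 𝓘(ℝ, Fin (k + 1) → E') 𝓘(ℝ, Fin (k + 1) → E') (jetCoord k ψ)
        (higherTangentMap k g hg u)
        (mfderiv 𝓘(ℝ, Fin (k + 1) → E) 𝓘(ℝ, Fin (k + 1) → E') (higherTangentMap k g hg) u w) =
      fderiv ℝ (jetMap k (ψ ∘ g ∘ φ.symm)) (jetCoord k φ u)
        (mfderiv 𝓘(ℝ, Fin (k + 1) → E) 𝓘(ℝ, Fin (k + 1) → E) (jetCoord k φ) u w) := by
  have hS := isOpen_chartDomain hg.continuous φ ψ
  have h0 : jetCoord k φ u 0 ∈ chartDomain g φ ψ := by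
    rw [jetCoord_zero hφ hu]; exact mem_chartDomain hu hu'
  have hj : MDifferentiableAt 𝓘(ℝ, Fin (k + 1) → E) 𝓘(ℝ, Fin (k + 1) → E')
      (jetMap k (ψ ∘ g ∘ φ.symm)) (jetCoord k φ u) :=
    (((contDiffOn_curveJet_comp_polyCurve hS (contDiffOn_chartDomain hg hφ hψ)).contDiffAt
      ((hS.preimage (continuous_apply 0)).mem_nhds h0)).differentiableAt
        (by simp)).mdifferentiableAt
  have hψu : MDifferentiableAt 𝓘(ℝ, Fin (k + 1) → E') 𝓘(ℝ, Fin (k + 1) → E') (jetCoord k ψ)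
      (higherTangentMap k g hg u) :=
    (contMDiffAt_jetCoord hψ (by rwa [proj_higherTangentMap])).mdifferentiableAt (by simp)
  have hnear := eventually_mem_chart_sources (k := k) hg.continuous φ ψ hu hu'
  have e : jetCoord k ψ ∘ higherTangentMap k g hg =ᶠ[𝓝 u]
      jetMap k (ψ ∘ g ∘ φ.symm) ∘ jetCoord k φ := by
    filter_upwards [hnear] with w hw
    exact jetCoord_higherTangentMap hg hφ hψ hw.1 hw.2
  have h1 := e.mfderiv_eq (I := 𝓘(ℝ, Fin (k + 1) → E)) (I' := 𝓘(ℝ, Fin (k + 1) → E'))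
  rw [mfderiv_comp u hψu ((contMDiff_higherTangentMap hg u).mdifferentiableAt (by simp)),
    mfderiv_comp u hj ((contMDiffAt_jetCoord hφ hu).mdifferentiableAt (by simp)),
    mfderiv_eq_fderiv] at h1
  exact congrArg (fun L : (Fin (k + 1) → E) →L[ℝ] (Fin (k + 1) → E') => L w) h1

end JetCharts

/-! ### The lifted connection: independence of charts. -/

section LiftedConnection

variable {E : Type*} [NormedAddCommGroup E] [NormedSpace ℝ E] {k : ℕ}
  {E' : Type*} [NormedAddCommGroup E'] [NormedSpace ℝ E']
  {M : Type*} [TopologicalSpace M] [ChartedSpace E M] [IsManifold 𝓘(ℝ, E) ∞ M]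
  {N : Type*} [TopologicalSpace N] [ChartedSpace E' N] [IsManifold 𝓘(ℝ, E') ∞ N]

theorem hasLocalComponents_iff {K : FiberMap E k M} {φ : OpenPartialHomeomorph M E}
    {C : (i : ℕ) → (Fin (i + 1) → E) → E →L[ℝ] E} :
    HasLocalComponents K φ C ↔ ∀ u : HigherTangentBundle E k M, u.proj ∈ φ.source →
      ∀ (v : TangentSpace 𝓘(ℝ, Fin (k + 1) → E) u) (i : Fin k),
        mfderiv 𝓘(ℝ, E) 𝓘(ℝ, E) φ u.proj (K u v i) =
          localSum C (jetCoord k φ u)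
            (mfderiv 𝓘(ℝ, Fin (k + 1) → E) 𝓘(ℝ, Fin (k + 1) → E) (jetCoord k φ) u v) i :=
  Iff.rfl

theorem LinearConnection.lift_apply (D : LinearConnection E M) (u : HigherTangentBundle E k M)
    (v : TangentSpace 𝓘(ℝ, Fin (k + 1) → E) u) (i : Fin k) :
    D.lift k u v i = localSum (liftComponent (D.christoffel (chartAt E u.proj)))
      (jetCoord k (chartAt E u.proj) u) v i := by
  have h (w : Fin (k + 1) → E) :
      (∑ j : Fin (i + 2), (liftComponent (D.christoffel (chartAt E u.proj)) j
        (fun l : Fin (j + 1) => jetCoord k (chartAt E u.proj) u ⟨l, by omega⟩)).comp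
          (ContinuousLinearMap.proj (R := ℝ) (φ := fun _ : Fin (k + 1) => E)
            ⟨i + 1 - j, by omega⟩)) w =
        localSum (liftComponent (D.christoffel (chartAt E u.proj)))
          (jetCoord k (chartAt E u.proj) u) w i := by
    rw [sum_apply]
    rfl
  exact h v

/-- Naturality of the lift, in arbitrary charts. -/
theorem localSum_higherTangentMap {g : M → N} (hg : ContMDiff 𝓘(ℝ, E) 𝓘(ℝ, E') ∞ g)
    (DM : LinearConnection E M) (DN : LinearConnection E' N)
    {φ : OpenPartialHomeomorph M E} (hφ : φ ∈ atlas E M) {ψ : OpenPartialHomeomorph N E'}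
    (hψ : ψ ∈ atlas E' N)
    (hrel : ∀ x ∈ chartDomain g φ ψ,
      ChristoffelRelatedAt (ψ ∘ g ∘ φ.symm) (DM.christoffel φ) (DN.christoffel ψ) x)
    {u : HigherTangentBundle E k M} (hu : u.proj ∈ φ.source)
    (hu' : g u.proj ∈ ψ.source) (w : TangentSpace 𝓘(ℝ, Fin (k + 1) → E) u) (i : Fin k) :
    localSum (liftComponent (DN.christoffel ψ)) (jetCoord k ψ (higherTangentMap k g hg u))
      (mfderiv 𝓘(ℝ, Fin (k + 1) → E') 𝓘(ℝ, Fin (k + 1) → E') (jetCoord k ψ)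
        (higherTangentMap k g hg u)
        (mfderiv 𝓘(ℝ, Fin (k + 1) → E) 𝓘(ℝ, Fin (k + 1) → E')
          (higherTangentMap k g hg) u w)) i =
      fderiv ℝ (ψ ∘ g ∘ φ.symm) (φ u.proj) (localSum (liftComponent (DM.christoffel φ))
        (jetCoord k φ u)
        (mfderiv 𝓘(ℝ, Fin (k + 1) → E) 𝓘(ℝ, Fin (k + 1) → E) (jetCoord k φ) u w) i) := by
  have h0 : jetCoord k φ u 0 ∈ chartDomain g φ ψ := by
    rw [jetCoord_zero hφ hu]; exact mem_chartDomain hu hu'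
  rw [mfderiv_jetCoord_higherTangentMap hg hφ hψ hu hu' w,
    jetCoord_higherTangentMap hg hφ hψ hu hu', ← jetCoord_zero hφ hu]
  exact localSum_map (isOpen_chartDomain hg.continuous φ ψ)
    ((DM.smooth φ hφ).mono inter_subset_left) ψ.open_target (DN.smooth ψ hψ)
    (contDiffOn_chartDomain hg hφ hψ) (mapsTo_chartDomain g φ ψ) hrel h0 _ i

/-- `D.lift k` is defined at `u` through the preferred chart only. Naturality for `g = id`, from
that chart to `φ`, transports the formula to `φ`. -/
theorem LinearConnection.hasLocalComponents_lift (D : LinearConnection E M)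
    {φ : OpenPartialHomeomorph M E} (hφ : φ ∈ atlas E M) :
    HasLocalComponents (D.lift k) φ (liftComponent (D.christoffel φ)) := by
  rw [hasLocalComponents_iff]
  intro u hu v i
  set c := chartAt E u.proj with hc
  have hcA : c ∈ atlas E M := chart_mem_atlas E u.proj
  have huc : u.proj ∈ c.source := mem_chart_source E u.proj
  have h := localSum_higherTangentMap (k := k) (g := id) contMDiff_id D D hcA hφ
    -- The transformation rule of `D` is the relation `ChristoffelRelatedAt` for the change of
    -- charts.
    (fun x hx ξ y => D.transform c hcA φ hφ x hx ξ y) huc hu v i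
  have h2 := fderiv_chart_mfderiv (g := id) contMDiff_id hcA hφ huc hu (D.lift k u v i)
  rw [mfderiv_chartAt_self] at h2
  rw [mfderiv_jetCoord_chartAt_self, ← LinearConnection.lift_apply, h2] at h
  -- `Tᵏ id` equals `id` only propositionally, and the tangent spaces depend on the base point;
  -- stating this for a variable `f` allows substitution.
  have hid (f : HigherTangentBundle E k M → HigherTangentBundle E k M) (hf : f = id) :
      localSum (liftComponent (D.christoffel φ)) (jetCoord k φ (f u))
        (mfderiv 𝓘(ℝ, Fin (k + 1) → E) 𝓘(ℝ, Fin (k + 1) → E) (jetCoord k φ) (f u)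
          (mfderiv 𝓘(ℝ, Fin (k + 1) → E) 𝓘(ℝ, Fin (k + 1) → E) f u v)) i =
      localSum (liftComponent (D.christoffel φ)) (jetCoord k φ u)
        (mfderiv 𝓘(ℝ, Fin (k + 1) → E) 𝓘(ℝ, Fin (k + 1) → E) (jetCoord k φ) u v) i := by
    subst hf
    rw [mfderiv_id]
    rfl
  rw [mfderiv_id] at h
  exact h.symm.trans (hid _ higherTangentMap_id)

/-! ### Relatedness of connections and of their lifts. -/

theorem areRelated_iff {g : M → N} {hg : ContMDiff 𝓘(ℝ, E) 𝓘(ℝ, E') ∞ g}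
    {KM : FiberMap E k M} {KN : FiberMap E' k N} :
    AreRelated g hg KM KN ↔ ∀ (u : HigherTangentBundle E k M)
      (w : TangentSpace 𝓘(ℝ, Fin (k + 1) → E) u) (i : Fin k),
      (KN (higherTangentMap k g hg u) (mfderiv 𝓘(ℝ, Fin (k + 1) → E) 𝓘(ℝ, Fin (k + 1) → E')
          (higherTangentMap k g hg) u w) i : E') =
        mfderiv 𝓘(ℝ, E) 𝓘(ℝ, E') g u.proj (KM u w i) := by
  constructor
  · intro h u w i
    have h1 := congrFun (h i) ⟨u, w⟩
    -- On a representative curve the two base points coincide definitionally, so the heterogeneous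
    -- equality of fibre components becomes an equality.
    induction u using Quotient.inductionOn with
    | h γ => exact eq_of_heq (Bundle.TotalSpace.mk.inj h1).2
  · intro h i
    funext ⟨u, w⟩
    have h1 := h u w i
    induction u using Quotient.inductionOn with
    | h γ => exact congrArg (Bundle.TotalSpace.mk (F := E') (E := TangentSpace 𝓘(ℝ, E'))
        (g (γ.1 0))) h1

/-- Every pair of local coordinates `(p, η)` comes from a tangent vector of `TM`, since the chart of
`T¹M` is onto its target and has surjective differential. Relatedness at these vectors is the
hypothesis of `ChristoffelRelatedAt.of_localSum`. -/
theorem LinearConnection.AreRelated.christoffelRelatedAt {g : M → N}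
    {hg : ContMDiff 𝓘(ℝ, E) 𝓘(ℝ, E') ∞ g} {DM : LinearConnection E M}
    {DN : LinearConnection E' N} (h : LinearConnection.AreRelated g hg DM DN)
    {φ : OpenPartialHomeomorph M E} (hφ : φ ∈ atlas E M) {ψ : OpenPartialHomeomorph N E'}
    (hψ : ψ ∈ atlas E' N) {x : E} (hx : x ∈ chartDomain g φ ψ) :
    ChristoffelRelatedAt (ψ ∘ g ∘ φ.symm) (DM.christoffel φ) (DN.christoffel ψ) x := by
  refine .of_localSum (isOpen_chartDomain hg.continuous φ ψ) (contDiffOn_chartDomain hg hφ hψ) hx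
    fun p η hp => ?_
  have hpt : p ∈ (jetOpenChart (M := M) 1 ⟨φ, hφ⟩).target := by
    change p 0 ∈ φ.target
    rw [hp]
    exact hx.1
  obtain ⟨u, hu, rfl⟩ : ∃ u : HigherTangentBundle E 1 M, u.proj ∈ φ.source ∧ jetCoord 1 φ u = p :=
    ⟨_, (jetOpenChart 1 ⟨φ, hφ⟩).map_target hpt, (jetOpenChart 1 ⟨φ, hφ⟩).right_inv hpt⟩
  obtain ⟨w, rfl⟩ := (mdifferentiable_of_mem_atlas (I := 𝓘(ℝ, Fin 2 → E))
    (jetOpenChart_mem_atlas (k := 1) ⟨φ, hφ⟩)).mfderiv_surjective hu η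
  rw [jetCoord_zero hφ hu] at hp
  subst hp
  have hu' : g u.proj ∈ ψ.source := by simpa [φ.left_inv hu] using hx.2
  have h1 := areRelated_iff.1 h u w 0
  have h2 := hasLocalComponents_iff.1 (DM.hasLocalComponents_lift (k := 1) hφ) u hu w 0
  have h3 := hasLocalComponents_iff.1 (DN.hasLocalComponents_lift (k := 1) hψ)
    (higherTangentMap 1 g hg u) (by rwa [proj_higherTangentMap])
    (mfderiv 𝓘(ℝ, Fin 2 → E) 𝓘(ℝ, Fin 2 → E') (higherTangentMap 1 g hg) u w) 0
  have h4 := fderiv_chart_mfderiv hg hφ hψ hu hu' (DM.lift 1 u w 0)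
  rw [h2, ← h1] at h4
  rw [mfderiv_jetCoord_higherTangentMap hg hφ hψ hu hu' w,
    jetCoord_higherTangentMap hg hφ hψ hu hu', proj_higherTangentMap] at h3
  exact h3.symm.trans h4.symm

theorem LinearConnection.AreRelated.lift {g : M → N}
    {hg : ContMDiff 𝓘(ℝ, E) 𝓘(ℝ, E') ∞ g} {DM : LinearConnection E M}
    {DN : LinearConnection E' N} (h : LinearConnection.AreRelated g hg DM DN) (k : ℕ) :
    HigherTangent.AreRelated g hg (DM.lift k) (DN.lift k) := by
  rw [areRelated_iff]
  intro u w i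
  have hφ := chart_mem_atlas E u.proj
  have hu := mem_chart_source E u.proj
  -- The chart is taken at the projection of `Tᵏg u`, where `DN.lift` is evaluated, so that its
  -- differentials there are identities.
  have hψ := chart_mem_atlas E' (higherTangentMap k g hg u).proj
  have hu' : g u.proj ∈ (chartAt E' (higherTangentMap k g hg u).proj).source := by
    rw [← proj_higherTangentMap hg]
    exact mem_chart_source E' (higherTangentMap k g hg u).proj
  have h1 := localSum_higherTangentMap hg DM DN hφ hψ
    (fun x hx => h.christoffelRelatedAt hφ hψ hx) hu hu' w i
  rw [mfderiv_jetCoord_chartAt_self, mfderiv_jetCoord_chartAt_self,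
    ← LinearConnection.lift_apply, ← LinearConnection.lift_apply] at h1
  have h2 := fderiv_chart_mfderiv hg hφ hψ hu hu' (DM.lift k u w i)
  rw [mfderiv_chartAt_self] at h2
  refine h1.trans (h2.trans ?_)
  rw [proj_higherTangentMap]
  exact mfderiv_chartAt_self (g u.proj) _

/-! ### The identities for `𝕁`, smoothness, and the connection map property. -/

theorem shift_pow_apply (a : ℕ) (v : Fin (k + 1) → E) (m : Fin (k + 1)) :
    (shift E k ^ a) v m = if h : a ≤ m then v ⟨m - a, by omega⟩ else 0 := by
  induction a generalizing m with
  | zero => simp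
  | succ a ih =>
    rw [pow_succ', mul_apply_eq_comp]
    cases m using Fin.cases with
    | zero => simp [shift]
    | succ m =>
      change (shift E k ^ a) v m.castSucc = _
      rw [ih]
      simp [Nat.add_sub_add_right]

/-- In the top component the `j`-th term reads entry `k - j`, which after `a` shifts is the old
entry `k - a - j = i + 1 - j`, or zero once `j ≥ i + 2`. The surviving terms are those of the lower
component. -/
theorem localSum_shift_pow (C : (i : ℕ) → (Fin (i + 1) → E) → E →L[ℝ] E) (a : ℕ) (i l : Fin k)
    (hl : (l : ℕ) + 1 = k) (hi : (i : ℕ) + 1 + a = k) (u v : Fin (k + 1) → E) :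
    localSum C u ((shift E k ^ a) v) l = localSum C u v i := by
  symm
  refine Finset.sum_of_injOn (Fin.castLE (by omega)) (Fin.castLE_injective _).injOn
    (fun _ _ => Finset.mem_univ _) (fun j _ hj => ?_) fun j _ => ?_
  · have hj' : (i : ℕ) + 2 ≤ j := by
      by_contra! h
      exact hj ⟨⟨j, h⟩, Finset.mem_coe.2 (Finset.mem_univ _), rfl⟩
    rw [shift_pow_apply, dif_neg (by simp only []; omega), map_zero]
  · have := j.2
    rw [shift_pow_apply, dif_pos (by simp only [Fin.val_castLE]; omega)]
    congr 2
    simp only [Fin.val_castLE, Fin.mk.injEq]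
    omega

theorem localSum_shift_pow_last (C : (i : ℕ) → (Fin (i + 1) → E) → E →L[ℝ] E) (l : Fin k)
    (hl : (l : ℕ) + 1 = k) (u v : Fin (k + 1) → E) :
    localSum C u ((shift E k ^ k) v) l = C 0 (fun _ => u 0) (v 0) := by
  rw [localSum, Finset.sum_eq_single 0]
  · rw [shift_pow_apply, dif_pos (by simp only [Fin.val_zero]; omega)]
    have h1 : (fun m : Fin 1 => u ⟨m, by omega⟩) = fun _ => u 0 := by
      funext m
      congr 1
      exact Fin.ext (by simp)
    have h2 : (⟨(l : ℕ) + 1 - 0 - k, by omega⟩ : Fin (k + 1)) = 0 := Fin.ext (by simp)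
    change C 0 (fun m : Fin 1 => u ⟨m, by omega⟩) (v ⟨(l : ℕ) + 1 - 0 - k, by omega⟩) = _
    rw [h1, h2]
  · intro j _ hj
    have : (j : ℕ) ≠ 0 := fun h => hj (Fin.ext h)
    rw [shift_pow_apply, dif_neg (by simp only []; omega), map_zero]
  · simp

theorem mfderiv_chart_mfderiv_proj {φ : OpenPartialHomeomorph M E} (hφ : φ ∈ atlas E M)
    {u : HigherTangentBundle E k M} (hu : u.proj ∈ φ.source)
    (w : TangentSpace 𝓘(ℝ, Fin (k + 1) → E) u) :
    mfderiv 𝓘(ℝ, E) 𝓘(ℝ, E) φ u.proj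
        (mfderiv 𝓘(ℝ, Fin (k + 1) → E) 𝓘(ℝ, E) HigherTangentBundle.proj u w) =
      mfderiv 𝓘(ℝ, Fin (k + 1) → E) 𝓘(ℝ, Fin (k + 1) → E) (jetCoord k φ) u w 0 := by
  have hφx : MDifferentiableAt 𝓘(ℝ, E) 𝓘(ℝ, E) φ u.proj := mdifferentiableAt_atlas hφ hu
  have h0 : MDifferentiableAt 𝓘(ℝ, Fin (k + 1) → E) 𝓘(ℝ, E)
      (ContinuousLinearMap.proj (R := ℝ) (φ := fun _ : Fin (k + 1) => E) 0) (jetCoord k φ u) :=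
    (ContinuousLinearMap.differentiableAt _).mdifferentiableAt
  have e : φ ∘ HigherTangentBundle.proj =ᶠ[𝓝 u]
      (ContinuousLinearMap.proj (R := ℝ) (φ := fun _ : Fin (k + 1) => E) 0) ∘ jetCoord k φ := by
    filter_upwards [(isOpen_proj_preimage_source (k := k) hφ).mem_nhds hu] with y hy
    exact (jetCoord_zero hφ hy).symm
  have h1 := e.mfderiv_eq (I := 𝓘(ℝ, Fin (k + 1) → E)) (I' := 𝓘(ℝ, E))
  rw [mfderiv_comp u hφx (contMDiff_proj.mdifferentiable (by simp) u),
    mfderiv_comp u h0 ((contMDiffAt_jetCoord hφ hu).mdifferentiableAt (by simp)),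
    mfderiv_eq_fderiv, ContinuousLinearMap.fderiv] at h1
  exact congrArg (fun L : (Fin (k + 1) → E) →L[ℝ] E => L w) h1

/-- Smoothness into a tangent bundle is tested in trivialisations, while the local formula speaks of
differentials of charts; this translates between them. -/
theorem trivializationAt_snd_eq_mfderiv (x : M) (z : TangentBundle 𝓘(ℝ, E) M)
    (hz : z.proj ∈ (chartAt E x).source) :
    (trivializationAt E (TangentSpace 𝓘(ℝ, E)) x z).2 =
      mfderiv 𝓘(ℝ, E) 𝓘(ℝ, E) (chartAt E x) z.proj z.2 := by
  have h := (mdifferentiableAt_atlas (I := 𝓘(ℝ, E)) (chart_mem_atlas E x) hz)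
  rw [TangentBundle.trivializationAt_apply, h.mfderiv]
  simp [writtenInExtChartAt, extChartAt]
  rfl

/-- The chart in the definition of the lift varies with the point. By `hasLocalComponents_lift` one
fixed chart serves a whole neighbourhood, and there the map is the smooth `localSum`. -/
theorem LinearConnection.contMDiff_lift_total (D : LinearConnection E M) (i : Fin k) :
    ContMDiff (𝓘(ℝ, Fin (k + 1) → E).tangent) (𝓘(ℝ, E).tangent) ∞ ((D.lift k).total i) := by
  intro v₀
  have hproj : ContMDiff (𝓘(ℝ, Fin (k + 1) → E).tangent) 𝓘(ℝ, Fin (k + 1) → E) ∞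
      (fun v : TangentBundle 𝓘(ℝ, Fin (k + 1) → E) (HigherTangentBundle E k M) => v.proj) :=
    Bundle.contMDiff_proj _
  refine Bundle.contMDiffAt_totalSpace.2 ⟨(contMDiff_proj.comp hproj) v₀, ?_⟩
  set φ := chartAt E v₀.proj.proj
  have hφ : φ ∈ atlas E M := chart_mem_atlas E _
  have h0 : v₀.proj.proj ∈ φ.source := mem_chart_source E _
  have h1 : ContMDiffAt (𝓘(ℝ, Fin (k + 1) → E).tangent) 𝓘(ℝ, Fin (k + 1) → E) ∞
      (fun v : TangentBundle 𝓘(ℝ, Fin (k + 1) → E) (HigherTangentBundle E k M) =>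
        jetCoord k φ v.proj) v₀ := (contMDiffAt_jetCoord hφ h0).comp v₀ (hproj v₀)
  have h2 : ContMDiffAt (𝓘(ℝ, Fin (k + 1) → E).tangent) 𝓘(ℝ, Fin (k + 1) → E) ∞
      (fun v : TangentBundle 𝓘(ℝ, Fin (k + 1) → E) (HigherTangentBundle E k M) =>
        (trivializationAt (Fin (k + 1) → E) (TangentSpace 𝓘(ℝ, Fin (k + 1) → E))
          v₀.proj v).2) v₀ :=
    (Bundle.contMDiffAt_totalSpace.1 (contMDiffAt_id (x := v₀))).2
  have hmem : (jetCoord k φ v₀.proj) 0 ∈ φ.target := by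
    rw [jetCoord_zero hφ h0]; exact φ.map_source h0
  have h3 := ((contDiffOn_localSum φ.open_target (D.smooth φ hφ) i).contDiffAt
    (x := (jetCoord k φ v₀.proj, (trivializationAt (Fin (k + 1) → E)
      (TangentSpace 𝓘(ℝ, Fin (k + 1) → E)) v₀.proj v₀).2))
    ((φ.open_target.preimage (by fun_prop : Continuous
      fun q : (Fin (k + 1) → E) × (Fin (k + 1) → E) => q.1 0)).mem_nhds hmem)).contMDiffAt
  refine (h3.comp v₀ (h1.prodMk_space h2)).congr_of_eventuallyEq ?_
  have hnear := (((isOpen_proj_preimage_source (k := k) hφ).preimage hproj.continuous).mem_nhds h0)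
  filter_upwards [hnear] with v hv
  have hv' : v.proj.proj ∈ φ.source := hv
  have h4 := trivializationAt_snd_eq_mfderiv v₀.proj.proj ((D.lift k).total i v) hv'
  have h5 := trivializationAt_snd_eq_mfderiv v₀.proj v hv'
  have h6 := hasLocalComponents_iff.1 (D.hasLocalComponents_lift (k := k) hφ) v.proj hv' v.2 i
  simp only [Function.comp_apply]
  rw [h5]
  exact h4.trans h6

theorem LinearConnection.isConnectionMap_lift (D : LinearConnection E M) (k : ℕ) :
    IsConnectionMap (D.lift k) where
  smooth := D.contMDiff_lift_total
  comp_vertEndo a i l hl ha hi u v := by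
    exact (D.lift_apply u _ l).trans ((localSum_shift_pow (E := E) _ a i l hl hi _ v).trans
      (D.lift_apply u v i).symm)
  comp_vertEndo_last l hl u v := by
    have h := mfderiv_chart_mfderiv_proj (k := k) (chart_mem_atlas E u.proj)
      (mem_chart_source E u.proj) v
    rw [mfderiv_chartAt_self, mfderiv_jetCoord_chartAt_self] at h
    exact (D.lift_apply u _ l).trans
      ((localSum_shift_pow_last (E := E) _ l hl _ v).trans h.symm)

end LiftedConnection

end HigherTangent

end

theorem mainTheorem2
    {E : Type*} [NormedAddCommGroup E] [NormedSpace ℝ E] [CompleteSpace E]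
    {E' : Type*} [NormedAddCommGroup E'] [NormedSpace ℝ E'] [CompleteSpace E']
    {M : Type*} [TopologicalSpace M] [ChartedSpace E M] [IsManifold 𝓘(ℝ, E) ∞ M]
    {N : Type*} [TopologicalSpace N] [ChartedSpace E' N] [IsManifold 𝓘(ℝ, E') ∞ N]
    (g : M → N) (hg : ContMDiff 𝓘(ℝ, E) 𝓘(ℝ, E') ∞ g)
    (DM : HigherTangent.LinearConnection E M) (DN : HigherTangent.LinearConnection E' N)
    (hrel : HigherTangent.LinearConnection.AreRelated g hg DM DN)
    (k : ℕ) (hk : 1 ≤ k) :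
    (HigherTangent.IsConnectionMap (DM.lift k) ∧
      ∀ φ ∈ atlas E M, HigherTangent.HasLocalComponents (DM.lift k) φ
        (HigherTangent.liftComponent (DM.christoffel φ))) ∧
    (HigherTangent.IsConnectionMap (DN.lift k) ∧
      ∀ ψ ∈ atlas E' N, HigherTangent.HasLocalComponents (DN.lift k) ψ
        (HigherTangent.liftComponent (DN.christoffel ψ))) ∧
    HigherTangent.AreRelated g hg (DM.lift k) (DN.lift k) := by
  exact ⟨⟨DM.isConnectionMap_lift k, fun _ hφ => DM.hasLocalComponents_lift hφ⟩,
    ⟨DN.isConnectionMap_lift k, fun _ hψ => DN.hasLocalComponents_lift hψ⟩, hrel.lift k⟩
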